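/- Let $n\ge 2$, $\lambda>1$ and $\nu=\sqrt{\lambda^2-1}$. For $u\in\mathbb{R}^{n-1}$ and $t>0$ let $$E_{u,t}=\Big\{x\in\mathbb{R}^n:\ \frac{(x_1-u_1)^2}{\lambda^2}+\sum_{i=2}^{n-1}\frac{(x_i-u_i)^2}{\nu^2}+\frac{x_n^2}{\nu^2}\le t^2\Big\}$$ be the solid ellipsoid of rotation of eccentricity $1/\lambda$ with foci $(u_1\pm t,u_2,\dots,u_{n-1},0)$, and for a locally integrable function $f:\mathbb{R}^n\to\mathbb{C}$ let $$R_Ef(u,t)=\int_{E_{u,t}}f(x)\,dx .$$ (For every $u$ the derivative $\partial_tR_Ef(u,t)$ exists for almost every $t>0$.) For $\gamma\ge 0$ let $\mathcal H^\gamma_e(\mathbb{R}^n)$ be the set of $f\in L^2(\mathbb{R}^n)$ that satisfy $f(x',-x_n)=f(x',x_n)$ for almost every $x=(x',x_n)$ and $$\|f\|_\gamma^2:=\int_{\mathbb{R}^n}|\hat f(\xi)|^2(1+|\xi|^2)^\gamma\,d\xi<\infty,\qquad \hat f(\xi)=\int_{\mathbb{R}^n}f(x)e^{-ix\cdot\xi}\,dx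 .$$ For a measurable function $g$ on $\mathbb{R}^{n-1}\times[0,\infty)$ with $\int_{\mathbb{R}^{n-1}}\int_0^\infty|g(u,t)|^2t^{n-1}\,dt\,du<\infty$, let $\tilde g$ be the function on $\mathbb{R}^{n-1}\times[0,\infty)$ determined almost everywhere by $$\tilde g(\xi',|\zeta|)=\int_{\mathbb{R}^{n-1}}\int_{\mathbb{R}^n}g(u,|w|)\,e^{-i(u,w)\cdot(\xi',\zeta)}\,dw\,du\qquad(\xi'\in\mathbb{R}^{n-1},\ \zeta\in\mathbb{R}^n),$$ and for $s\ge 0$ put $$\|g\|_s^2:=\int_{\mathbb{R}^{n-1}}\int_0^\infty|\tilde g(\xi',\eta)|^2(1+|\xi'|^2+\eta^2)^s\,\eta^{n-1}\,d\eta\,d\xi'\in[0,\infty];$$ for all other $g$ put $\|g\|_s=\infty$. The Fourier integrals are understood in the $L^2$ (Plancherel) sense. Then for every $\gamma\ge 0$ there is a constant $C>0$, depending only on $n$, $\lambda$ and $\gamma$, such that for every $f\in\mathcal H^\gamma_e(\mathbb{R}^n)$ $$\|f\|_\gamma\le C\,\big\|t^{1-n}\,\partial_tR_Ef\big\|_{\gamma+(n-1)/2}$$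 (an inequality in $[0,\infty]$). -/

import Mathlib

open MeasureTheory Set
open scoped ENNReal FourierTransform

noncomputable section

namespace EllipticalRadon

/-- Euclidean space `ℝᵏ`. -/
abbrev E (k : ℕ) : Type := EuclideanSpace ℝ (Fin k)

/-- The Euclidean space `ℝᵈ × ℝᵈ⁺¹` (with the Euclidean, not the sup, norm). -/
abbrev EProd (d : ℕ) : Type := WithLp 2 (E d × E (d + 1))

/-! Throughout the ambient dimension is `n = d + 1` with `d ≥ 1`. A point of `ℝⁿ` is
`x = (x', xₙ)`, where `xₙ = x (Fin.last d)` and `x'` has the coordinates `x i.castSucc`, `i < d`. -/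

/-- The solid ellipsoid of rotation `E_{u,t}` of eccentricity `1/lam` with foci
`(u₁ ± t, u₂, …, u_{n-1}, 0)`. -/
def ellipsoid {d : ℕ} (lam : ℝ) (u : E d) (t : ℝ) : Set (E (d + 1)) :=
  {x | (∑ i : Fin d,
      (x i.castSucc - u i) ^ 2 / (if (i : ℕ) = 0 then lam ^ 2 else lam ^ 2 - 1))
      + x (Fin.last d) ^ 2 / (lam ^ 2 - 1) ≤ t ^ 2}

/-- The elliptical Radon transform `R_E f (u, t)`. -/
def RE {d : ℕ} (lam : ℝ) (f : E (d + 1) → ℂ) (u : E d) (t : ℝ) : ℂ :=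
  ∫ x in ellipsoid lam u t, f x

/-- `t^{1-n} ∂ₜ R_E f (u, t)`, `n = d + 1`. For locally integrable `f` and each `u`, the function
`t ↦ R_E f (u, t)` is locally absolutely continuous on `(0, ∞)` by polar coordinates, so
the derivative exists for almost every `t > 0`. -/
def dataRE {d : ℕ} (lam : ℝ) (f : E (d + 1) → ℂ) (u : E d) (t : ℝ) : ℂ :=
  ((t ^ d)⁻¹ : ℝ) * deriv (fun s : ℝ => RE lam f u s) t

/-- The `L²` (Plancherel) extension of the unnormalized Fourier transform
`f̂(ξ) = ∫ f(x) e^{-i x·ξ} dx`, obtained from Mathlib's `∫ f(x) e^{-2πi x·ξ} dx` by scaling. -/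
def angFourier {V : Type*} [NormedAddCommGroup V] [InnerProductSpace ℝ V] [FiniteDimensional ℝ V]
    [MeasurableSpace V] [BorelSpace V] (f : Lp ℂ 2 (volume : Measure V)) (ξ : V) : ℂ :=
  (𝓕 f : Lp ℂ 2 (volume : Measure V)) ((2 * Real.pi)⁻¹ • ξ)

/-- The Sobolev norm `‖f‖_γ = (∫ |f̂(ξ)|² (1 + |ξ|²)^γ dξ)^{1/2}`, with values in `[0, ∞]`. -/
def sobolevNorm {k : ℕ} (γ : ℝ) (f : Lp ℂ 2 (volume : Measure (E k))) : ℝ≥0∞ :=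
  (∫⁻ ξ : E k, ‖angFourier f ξ‖ₑ ^ 2 * ENNReal.ofReal ((1 + ‖ξ‖ ^ 2) ^ γ)) ^ (1 / 2 : ℝ)

/-- The reflection `(x', xₙ) ↦ (x', -xₙ)`. -/
def reflect {d : ℕ} (x : E (d + 1)) : E (d + 1) :=
  WithLp.toLp 2 fun i => if i = Fin.last d then -x i else x i

/-- The space `H^γ_e(ℝⁿ)` for `γ ≥ 0`: the functions in `L²` of finite Sobolev norm of order `γ`
that are even in `xₙ`. -/
def sobolevEven (d : ℕ) (γ : ℝ) : Set (Lp ℂ 2 (volume : Measure (E (d + 1)))) :=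
  {f | sobolevNorm γ f < ∞ ∧ ∀ᵐ x : E (d + 1), f (reflect x) = f x}

/-- The measure `t^{n-1} dt` on `(0, ∞)`, `n = d + 1`. -/
def radialMeasure (d : ℕ) : Measure ℝ :=
  (volume.restrict (Ioi 0)).withDensity fun t => ENNReal.ofReal (t ^ d)

/-- Membership in `L²_{n-1}(ℝⁿ⁻¹ × [0, ∞))`: `g` is (a.e. strongly) measurable and
`∫∫ |g(u, t)|² t^{n-1} dt du < ∞`. -/
def MemL2Radial {d : ℕ} (g : E d → ℝ → ℂ) : Prop :=
  MemLp (fun p : E d × ℝ => g p.1 p.2) 2 ((volume : Measure (E d)).prod (radialMeasure d))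

/-- The function `(u, w) ↦ g(u, |w|)` on `ℝⁿ⁻¹ × ℝⁿ`. -/
def radialLift {d : ℕ} (g : E d → ℝ → ℂ) (z : EProd d) : ℂ := g z.fst ‖z.snd‖

lemma map_norm_volume (d : ℕ) :
    Measure.map (fun w : E (d + 1) => ‖w‖) volume =
      (volume : Measure (E (d + 1))).toSphere univ • radialMeasure d := by
  have hdim : Module.finrank ℝ (E (d + 1)) - 1 = d := by simp
  have hmp := (volume : Measure (E (d + 1))).measurePreserving_homeomorphUnitSphereProd
  rw [hdim] at hmp
  ext s hs
  rw [Measure.map_apply measurable_norm hs, Measure.smul_apply, smul_eq_mul, radialMeasure,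
    withDensity_apply _ hs, Measure.restrict_restrict hs]
  have hpre : MeasurableSet {r : Ioi (0 : ℝ) | (r : ℝ) ∈ s} := measurable_subtype_coe hs
  have h1 := hmp.measure_preimage (s := univ ×ˢ {r : Ioi (0 : ℝ) | (r : ℝ) ∈ s})
    (MeasurableSet.univ.prod hpre).nullMeasurableSet
  rw [Measure.prod_prod, comap_subtype_coe_apply (measurableSet_singleton _).compl,
    Measure.volumeIoiPow, withDensity_apply _ hpre,
    setLIntegral_subtype measurableSet_Ioi _ fun a : ℝ => ENNReal.ofReal (a ^ d)] at h1
  have himg : (Subtype.val '' {r : Ioi (0 : ℝ) | (r : ℝ) ∈ s}) = s ∩ Ioi 0 := by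
    ext x; simp [and_comm]
  rw [himg] at h1
  rw [← h1]
  apply measure_congr
  have h0 : ∀ᵐ x : E (d + 1), x ≠ 0 := by
    simp [ae_iff]
  filter_upwards [h0] with x hx
  apply propext
  change ‖x‖ ∈ s ↔ x ∈ Subtype.val '' ((homeomorphUnitSphereProd (E (d + 1))) ⁻¹'
    univ ×ˢ {r : Ioi (0 : ℝ) | (r : ℝ) ∈ s})
  simp only [mem_image, mem_preimage, mem_prod, mem_univ, true_and]
  constructor
  · intro h
    exact ⟨⟨x, hx⟩, by simpa using h, rfl⟩
  · rintro ⟨y, hy, rfl⟩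
    simpa using hy

/-- In polar coordinates, `g ∈ L²_{n-1}` lifts to a function in `L²(ℝⁿ⁻¹ × ℝⁿ)`. -/
lemma MemL2Radial.memLp_radialLift {d : ℕ} {g : E d → ℝ → ℂ} (hg : MemL2Radial g) :
    MemLp (radialLift g) 2 (volume : Measure (EProd d)) := by
  have hfin : (volume : Measure (E (d + 1))).toSphere univ ≠ ∞ := measure_ne_top _ _
  have hmap : Measure.map (Prod.map id fun w : E (d + 1) => ‖w‖)
      ((volume : Measure (E d)).prod (volume : Measure (E (d + 1)))) =
      (volume : Measure (E (d + 1))).toSphere univ •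
        ((volume : Measure (E d)).prod (radialMeasure d)) := by
    have : SFinite (radialMeasure d) := by unfold radialMeasure; infer_instance
    rw [← Measure.map_prod_map _ _ measurable_id measurable_norm, Measure.map_id,
      map_norm_volume, Measure.prod_smul_right]
  have h1 : MemLp (fun p : E d × ℝ => g p.1 p.2) 2
      (Measure.map (Prod.map id fun w : E (d + 1) => ‖w‖)
        ((volume : Measure (E d)).prod (volume : Measure (E (d + 1))))) := by
    rw [hmap]
    exact hg.smul_measure hfin
  have h2 := h1.comp_of_map (by fun_prop)
  exact h2.comp_measurePreserving (WithLp.volume_preserving_ofLp (U := E d) (V := E (d + 1)))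

/-- The transform `g̃(ξ', η)` of `g ∈ L²_{n-1}`, i.e. the function with
`g̃(ξ', |ζ|) = ∫∫ g(u, |w|) e^{-i (u, w)·(ξ', ζ)} dw du`. The Fourier transform on the right is an
element of `L²(ℝⁿ⁻¹ × ℝⁿ)` that is radial in `ζ`; its value at radius `η` is read off as its mean
over the sphere `|ζ| = η`, which makes it independent of the chosen representative. -/
def tilde {d : ℕ} {g : E d → ℝ → ℂ} (hg : MemL2Radial g) (ξ : E d) (η : ℝ) : ℂ :=
  ⨍ θ : Metric.sphere (0 : E (d + 1)) 1,
    angFourier (hg.memLp_radialLift.toLp (radialLift g))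
      (WithLp.toLp 2 (ξ, η • (θ : E (d + 1)))) ∂(volume : Measure (E (d + 1))).toSphere

open Classical in
/-- The norm of `H^s(ℝⁿ⁻¹ × [0, ∞))`,
`‖g‖_s = (∫∫ |g̃(ξ', η)|² (1 + |ξ'|² + |η|²)^s η^{n-1} dη dξ')^{1/2}`, with values in `[0, ∞]`;
it is `∞` when `g ∉ L²_{n-1}`. -/
def dataNorm {d : ℕ} (s : ℝ) (g : E d → ℝ → ℂ) : ℝ≥0∞ :=
  if hg : MemL2Radial g then
    (∫⁻ ξ : E d, ∫⁻ η in Ioi (0 : ℝ), ‖tilde hg ξ η‖ₑ ^ 2 *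
      ENNReal.ofReal ((1 + ‖ξ‖ ^ 2 + η ^ 2) ^ s * η ^ d)) ^ (1 / 2 : ℝ)
  else ∞

end EllipticalRadon

end

/-!
Write `n = d + 1`, let `D` be the diagonal map with entries the semi-axes `(lam, ν, …, ν)`,
`ν = √(lam² - 1)`, of `E_{0,1}`, and let `A (u, y) = (u, 0) + D y`. For fixed `u` the map `A` takes
the ball of radius `t` to the ellipsoid `E_{u,t}`, so in polar coordinates and by Lebesgue
differentiation the data `g = t^{1-n} ∂ₜ R_E f` are, up to the factor `|det D|`, the integrals of
`f (A (u, t θ))` over the unit sphere (`dataRE_eq_sphere_integral`). Both `y` and the variable `w`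
of the lift `G (u, w) = g (u, |w|)` range over `ℝⁿ`. Hence pairing `G` with a function `Φ` that is
radial in `w` gives a constant multiple of `∫ f (A z) Φ z dz`, and by Fubini, for `Φ = 𝓕 Ψ`, this is
`∫ f̂ (ξ) Ψ (Aᵀ ξ) dξ` with `Aᵀ ξ = (ξ', D ξ)` (`integral_comp_ellipsoidMap_mul_fourier`). So `Ĝ`,
averaged over spheres in `ζ`, is the pushforward of `f̂` under `ξ ↦ (ξ', |D ξ|)`
(`integral_angFourier_radialLift`).

Testing against the functions `χ (ξ, √(|ζ|² - q ξ) / ν)`, where `|D (ξ, κ)|² = q ξ + ν² κ²`, turns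
this into the pointwise identity, almost everywhere in `κ > 0`,
`f̂ (ξ', κ) = c (∂η/∂κ) η^{n-1} g̃ (ξ', η)` with `η = |D (ξ', κ)|` and `∂η/∂κ = ν² κ / η`
(`pullTilde_dataRE_ae`); this is where evenness of `f` in `xₙ` enters. Inserting it into the Sobolev
norm of `f` and changing variables from `κ` to `η`, the estimate reduces to the comparison
`(∂η/∂κ) η^{n-1} (1 + |ξ|²)^γ ≤ C (1 + |ξ'|² + η²)^{γ + (n-1)/2}` of weights, which holds because
`ν κ ≤ η` (`weight_le`).
-/

noncomputable section

namespace EllipticalRadon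

/-! ### Polar coordinates -/

section

instance (d : ℕ) : SFinite (radialMeasure d) := by unfold radialMeasure; infer_instance

lemma measurePreserving_coe_volumeIoiPow (d : ℕ) :
    MeasurePreserving (Subtype.val : Ioi (0 : ℝ) → ℝ) (Measure.volumeIoiPow d)
      (radialMeasure d) := by
  refine ⟨measurable_subtype_coe, ?_⟩
  ext s hs
  have hpre : MeasurableSet (Subtype.val ⁻¹' s : Set (Ioi (0 : ℝ))) := measurable_subtype_coe hs
  rw [Measure.map_apply measurable_subtype_coe hs, radialMeasure, withDensity_apply _ hs,
    Measure.restrict_restrict hs, Measure.volumeIoiPow, withDensity_apply _ hpre]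
  rw [setLIntegral_subtype measurableSet_Ioi _ fun a : ℝ => ENNReal.ofReal (a ^ d),
    Subtype.image_preimage_coe, inter_comm]

/-- Polar coordinates on `ℝᵈ⁺¹`, with the radius in `ℝ`. -/
lemma measurePreserving_polar (d : ℕ) :
    MeasurePreserving (fun p : Metric.sphere (0 : E (d + 1)) 1 × ℝ => p.2 • (p.1 : E (d + 1)))
      ((volume : Measure (E (d + 1))).toSphere.prod (radialMeasure d)) volume := by
  have hdim : Module.finrank ℝ (E (d + 1)) - 1 = d := by simp
  have hmp := (volume : Measure (E (d + 1))).measurePreserving_homeomorphUnitSphereProd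
  rw [hdim] at hmp
  have h1 : MeasurePreserving (homeomorphUnitSphereProd (E (d + 1))).symm
      ((volume : Measure (E (d + 1))).toSphere.prod (Measure.volumeIoiPow d))
      ((volume : Measure (E (d + 1))).comap (↑)) :=
    hmp.symm (homeomorphUnitSphereProd (E (d + 1))).toMeasurableEquiv
  have h2 : MeasurePreserving (Subtype.val : ({0}ᶜ : Set (E (d + 1))) → E (d + 1))
      ((volume : Measure (E (d + 1))).comap (↑)) volume := by
    refine ⟨measurable_subtype_coe, ?_⟩
    rw [map_comap_subtype_coe (measurableSet_singleton _).compl]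
    rw [Measure.restrict_eq_self_of_ae_mem]
    simp [ae_iff]
  have h3 := h2.comp h1
  have h4 : MeasurePreserving (Prod.map id (Subtype.val : Ioi (0 : ℝ) → ℝ))
      ((volume : Measure (E (d + 1))).toSphere.prod (Measure.volumeIoiPow d))
      ((volume : Measure (E (d + 1))).toSphere.prod (radialMeasure d)) :=
    (MeasurePreserving.id _).prod (measurePreserving_coe_volumeIoiPow d)
  refine ⟨by fun_prop, ?_⟩
  rw [← h4.map_eq, Measure.map_map (by fun_prop) h4.measurable]
  exact h3.map_eq

lemma integral_radialMeasure {F : Type*} [NormedAddCommGroup F] [NormedSpace ℝ F] (d : ℕ)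
    (h : ℝ → F) : ∫ r, h r ∂radialMeasure d = ∫ r in Ioi 0, (r ^ d) • h r := by
  rw [radialMeasure, integral_withDensity_eq_integral_toReal_smul (by fun_prop) (by simp)]
  refine setIntegral_congr_fun measurableSet_Ioi fun r hr => ?_
  rw [ENNReal.toReal_ofReal (pow_nonneg (le_of_lt hr) _)]

lemma integrable_radialMeasure_iff {F : Type*} [NormedAddCommGroup F] [NormedSpace ℝ F] (d : ℕ)
    {h : ℝ → F} :
    Integrable h (radialMeasure d) ↔ IntegrableOn (fun r => (r ^ d) • h r) (Ioi 0) := by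
  rw [radialMeasure, integrable_withDensity_iff_integrable_smul₀' (by fun_prop) (by simp)]
  refine integrable_congr ?_
  filter_upwards [ae_restrict_mem measurableSet_Ioi] with r hr
  rw [ENNReal.toReal_ofReal (pow_nonneg (le_of_lt hr) _)]

lemma integrable_polar {F : Type*} [NormedAddCommGroup F] {d : ℕ} {H : E (d + 1) → F}
    (hH : Integrable H) :
    Integrable (fun p : Metric.sphere (0 : E (d + 1)) 1 × ℝ => H (p.2 • (p.1 : E (d + 1))))
      ((volume : Measure (E (d + 1))).toSphere.prod (radialMeasure d)) :=
  ((measurePreserving_polar d).integrable_comp hH.1).2 hH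

variable {F : Type*} [NormedAddCommGroup F] [NormedSpace ℝ F]

lemma integrableOn_sphere_integral {d : ℕ} {H : E (d + 1) → F} (hH : Integrable H) :
    IntegrableOn (fun r : ℝ => (r ^ d) • ∫ θ : Metric.sphere (0 : E (d + 1)) 1,
      H (r • (θ : E (d + 1))) ∂(volume : Measure (E (d + 1))).toSphere) (Ioi 0) :=
  (integrable_radialMeasure_iff d).1 (integrable_polar hH).integral_prod_right

lemma integral_polar {d : ℕ} {H : E (d + 1) → F} (hH : Integrable H) :
    ∫ x, H x = ∫ r in Ioi (0 : ℝ), (r ^ d) • ∫ θ : Metric.sphere (0 : E (d + 1)) 1,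
      H (r • (θ : E (d + 1))) ∂(volume : Measure (E (d + 1))).toSphere := by
  rw [← integral_radialMeasure, ← integral_prod_symm _ (integrable_polar hH),
    ← integral_map (f := H) (measurePreserving_polar d).measurable.aemeasurable
      (by rw [(measurePreserving_polar d).map_eq]; exact hH.1),
    (measurePreserving_polar d).map_eq]

end

/-! ### The data as integrals over ellipsoids -/

section

/-- The semi-axes `(lam, ν, …, ν)`, `ν = √(lam² - 1)`, of the ellipsoid `E_{u,1}`. The last index is
not `0` as soon as `d ≥ 1`, so the last semi-axis is then `ν`. -/
def semiaxis {d : ℕ} (lam : ℝ) (i : Fin (d + 1)) : ℝ :=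
  if (i : ℕ) = 0 then lam else √(lam ^ 2 - 1)

lemma semiaxis_pos {d : ℕ} {lam : ℝ} (hlam : 1 < lam) (i : Fin (d + 1)) :
    0 < semiaxis lam i := by
  unfold semiaxis
  split_ifs
  · linarith
  · exact Real.sqrt_pos.2 (by nlinarith)

/-- The linear map that takes the unit ball of `ℝᵈ⁺¹` to the ellipsoid `E_{0,1}`. -/
def dilation (d : ℕ) (lam : ℝ) : E (d + 1) →ₗ[ℝ] E (d + 1) where
  toFun y := WithLp.toLp 2 fun i => semiaxis lam i * y i
  map_add' x y := by ext i; simp [mul_add]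
  map_smul' c x := by ext i; simp; ring

/-- The inclusion `u ↦ (u, 0)` of the hyperplane of centres. -/
def hyperplaneIncl (d : ℕ) : E d →ₗ[ℝ] E (d + 1) where
  toFun u := WithLp.toLp 2 (Fin.snoc (α := fun _ => ℝ) (fun i => u i) 0)
  map_add' x y := by ext i; induction i using Fin.lastCases <;> simp
  map_smul' c x := by ext i; induction i using Fin.lastCases <;> simp

/-- The linear map `(u, y) ↦ (u, 0) + D y`, where `D` is the dilation onto `E_{0,1}`. For fixed `u`
it takes the ball of radius `t` to the ellipsoid `E_{u,t}`. -/
def ellipsoidMap (d : ℕ) (lam : ℝ) : EProd d →L[ℝ] E (d + 1) :=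
  (hyperplaneIncl d).toContinuousLinearMap ∘L WithLp.fstL 2 ℝ (E d) (E (d + 1)) +
    (dilation d lam).toContinuousLinearMap ∘L WithLp.sndL 2 ℝ (E d) (E (d + 1))

lemma measurable_ellipsoidMap_slice {d : ℕ} (lam : ℝ) (u : E d) :
    Measurable fun y : E (d + 1) => ellipsoidMap d lam (WithLp.toLp 2 (u, y)) :=
  ((ellipsoidMap d lam).continuous.comp
    (by fun_prop : Continuous fun y : E (d + 1) => (WithLp.toLp 2 (u, y) : EProd d))).measurable

lemma ellipsoidMap_castSucc {d : ℕ} (lam : ℝ) (z : EProd d) (i : Fin d) :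
    ellipsoidMap d lam z i.castSucc = z.fst i + semiaxis lam i.castSucc * z.snd i.castSucc := by
  simp [ellipsoidMap, hyperplaneIncl, dilation]

lemma ellipsoidMap_last {d : ℕ} (lam : ℝ) (z : EProd d) :
    ellipsoidMap d lam z (Fin.last d) = semiaxis lam (Fin.last d) * z.snd (Fin.last d) := by
  simp [ellipsoidMap, hyperplaneIncl, dilation]

lemma det_dilation_ne_zero {d : ℕ} {lam : ℝ} (hlam : 1 < lam) :
    LinearMap.det (dilation d lam) ≠ 0 := by
  have : Function.Injective (dilation d lam) := by
    intro x y hxy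
    ext i
    have := congrArg (fun v : E (d + 1) => v i) hxy
    simpa [dilation, (semiaxis_pos hlam i).ne'] using this
  have h2 : IsUnit (dilation d lam) :=
    (LinearMap.isUnit_iff_ker_eq_bot _).2 (LinearMap.ker_eq_bot.2 this)
  exact (LinearMap.isUnit_det _ h2).ne_zero

/-- The absolute value of the determinant of the dilation onto `E_{0,1}`. -/
def jac (d : ℕ) (lam : ℝ) : ℝ := |LinearMap.det (dilation d lam)|

lemma jac_pos {d : ℕ} {lam : ℝ} (hlam : 1 < lam) : 0 < jac d lam :=
  abs_pos.2 (det_dilation_ne_zero hlam)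

lemma map_ellipsoidMap {d : ℕ} {lam : ℝ} (hlam : 1 < lam) (u : E d) :
    Measure.map (fun y : E (d + 1) => ellipsoidMap d lam (WithLp.toLp 2 (u, y))) volume =
      ENNReal.ofReal (jac d lam)⁻¹ • volume := by
  have h1 := Measure.map_linearMap_addHaar_eq_smul_addHaar (volume : Measure (E (d + 1)))
    (det_dilation_ne_zero (d := d) hlam)
  have hm : Measurable (dilation d lam) :=
    (LinearMap.continuous_of_finiteDimensional _).measurable
  have : (fun y : E (d + 1) => ellipsoidMap d lam (WithLp.toLp 2 (u, y))) =
    (fun x => hyperplaneIncl d u + x) ∘ dilation d lam :=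
    rfl
  rw [this, ← Measure.map_map (by fun_prop) hm, h1, Measure.map_smul, map_add_left_eq_self, jac,
    abs_inv]

lemma memLp_comp_ellipsoidMap {d : ℕ} {lam : ℝ} (hlam : 1 < lam) {f : E (d + 1) → ℂ}
    (hf : MemLp f 2) (u : E d) :
    MemLp (fun y : E (d + 1) => f (ellipsoidMap d lam (WithLp.toLp 2 (u, y)))) 2 := by
  refine MemLp.comp_of_map (f := fun y : E (d + 1) => ellipsoidMap d lam (WithLp.toLp 2 (u, y)))
    (g := f) ?_ (measurable_ellipsoidMap_slice lam u).aemeasurable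
  rw [map_ellipsoidMap hlam]
  exact hf.smul_measure (by simp)

lemma integral_eq_jac_mul {d : ℕ} {lam : ℝ} (hlam : 1 < lam) {F : E (d + 1) → ℂ}
    (hF : AEStronglyMeasurable F) (u : E d) :
    ∫ x, F x = jac d lam * ∫ y, F (ellipsoidMap d lam (WithLp.toLp 2 (u, y))) := by
  rw [← integral_map (f := F)
    (φ := fun y : E (d + 1) => ellipsoidMap d lam (WithLp.toLp 2 (u, y)))
    (measurable_ellipsoidMap_slice lam u).aemeasurable
    (by rw [map_ellipsoidMap hlam]; exact hF.smul_measure _),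
    map_ellipsoidMap hlam, integral_smul_measure,
    ENNReal.toReal_ofReal (inv_nonneg.2 (jac_pos hlam).le), Complex.real_smul, ← mul_assoc,
    Complex.ofReal_inv, mul_inv_cancel₀ (by exact_mod_cast (jac_pos hlam).ne'), one_mul]

lemma ellipsoidMap_mem_ellipsoid {d : ℕ} (hd : 1 ≤ d) {lam : ℝ} (hlam : 1 < lam) (u : E d)
    (y : E (d + 1)) {t : ℝ} (ht : 0 ≤ t) :
    ellipsoidMap d lam (WithLp.toLp 2 (u, y)) ∈ ellipsoid lam u t ↔ ‖y‖ ≤ t := by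
  have h1 : 0 < lam ^ 2 - 1 := by nlinarith
  have h2 : lam ≠ 0 := by linarith
  rw [← abs_of_nonneg ht, ← abs_of_nonneg (norm_nonneg y), ← sq_le_sq,
    EuclideanSpace.real_norm_sq_eq,
    Fin.sum_univ_castSucc, ellipsoid, mem_ofPred_eq, ellipsoidMap_last]
  have h3 : semiaxis lam (Fin.last d) = √(lam ^ 2 - 1) := by
    simp [semiaxis, show d ≠ 0 by lia]
  have h4 : ∀ i : Fin d, (ellipsoidMap d lam (WithLp.toLp 2 (u, y)) i.castSucc - u i) ^ 2 /
      (if (i : ℕ) = 0 then lam ^ 2 else lam ^ 2 - 1) = y i.castSucc ^ 2 := by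
    intro i
    rw [ellipsoidMap_castSucc]
    change (u i + semiaxis lam i.castSucc * y i.castSucc - u i) ^ 2 / _ = _
    simp only [semiaxis, Fin.val_castSucc, add_sub_cancel_left, mul_pow]
    split_ifs
    · field_simp
    · rw [Real.sq_sqrt h1.le]; field_simp
  rw [Finset.sum_congr rfl fun i _ => h4 i, h3, mul_pow, Real.sq_sqrt h1.le]
  simp only [sq_abs]
  rw [mul_div_cancel_left₀ _ h1.ne']
  rfl

lemma measurableSet_ellipsoid {d : ℕ} (lam : ℝ) (u : E d) (t : ℝ) :
    MeasurableSet (ellipsoid lam u t) := by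
  unfold ellipsoid
  refine measurableSet_le (Measurable.add ?_ ?_) measurable_const
  · refine Finset.measurable_fun_sum _ fun i _ => Measurable.div_const ?_ _
    exact Measurable.pow_const (Measurable.sub_const (by fun_prop) _) 2
  · exact Measurable.div_const (Measurable.pow_const (by fun_prop) 2) _

/-- Polar coordinates on the ellipsoids: up to the factor `|det D|`, `R_E f(u, ·)` is the primitive
of `rᵈ` times the integral of `f` over the boundary of `E_{u,r}`, parametrized by the unit
sphere. -/
lemma RE_eq_intervalIntegral {d : ℕ} (hd : 1 ≤ d) {lam : ℝ} (hlam : 1 < lam) {f : E (d + 1) → ℂ}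
    (hf : MemLp f 2) (u : E d) :
    LocallyIntegrable (indicator (Ioi 0) fun r : ℝ =>
      r ^ d • ∫ θ : Metric.sphere (0 : E (d + 1)) 1,
        f (ellipsoidMap d lam (WithLp.toLp 2 (u, r • (θ : E (d + 1)))))
          ∂(volume : Measure (E (d + 1))).toSphere) ∧
    ∀ t : ℝ, 0 < t → RE lam f u t = jac d lam * ∫ r in (0)..t, (indicator (Ioi 0) fun r : ℝ =>
      r ^ d • ∫ θ : Metric.sphere (0 : E (d + 1)) 1,
        f (ellipsoidMap d lam (WithLp.toLp 2 (u, r • (θ : E (d + 1)))))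
          ∂(volume : Measure (E (d + 1))).toSphere) r := by
  set k : E (d + 1) → ℂ := fun y => f (ellipsoidMap d lam (WithLp.toLp 2 (u, y))) with hk
  have hkL : MemLp k 2 := memLp_comp_ellipsoidMap hlam hf u
  set m : ℝ → ℂ := fun r => r ^ d • ∫ θ : Metric.sphere (0 : E (d + 1)) 1,
        k (r • (θ : E (d + 1))) ∂(volume : Measure (E (d + 1))).toSphere with hm
  have hint : ∀ t : ℝ, Integrable ((Metric.closedBall (0 : E (d + 1)) t).indicator k) := by
    intro t
    rw [integrable_indicator_iff Metric.isClosed_closedBall.measurableSet]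
    have : IsFiniteMeasure (volume.restrict (Metric.closedBall (0 : E (d + 1)) t)) :=
      ⟨by simpa using (isCompact_closedBall (0 : E (d + 1)) t).measure_lt_top⟩
    exact (hkL.restrict _).integrable (by norm_num)
  -- cutting `k` off at `‖y‖ ≤ t` cuts the radial integral off at `r ≤ t`
  have hsl : ∀ t : ℝ, ∀ r ∈ Ioi (0 : ℝ), r ^ d • ∫ θ : Metric.sphere (0 : E (d + 1)) 1,
      (Metric.closedBall (0 : E (d + 1)) t).indicator k (r • (θ : E (d + 1)))
        ∂(volume : Measure (E (d + 1))).toSphere = (Iic t).indicator m r := by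
    intro t r hr
    have h0 : ∀ θ : Metric.sphere (0 : E (d + 1)) 1, ‖r • (θ : E (d + 1))‖ = r := by
      intro θ
      rw [norm_smul, norm_eq_of_mem_sphere, mul_one, Real.norm_of_nonneg (le_of_lt hr)]
    by_cases h : r ≤ t
    · simp [indicator, h0, h, hm]
    · simp [indicator, h0, h]
  constructor
  · rw [locallyIntegrable_iff]
    intro K hK
    obtain ⟨T, hT⟩ := hK.isBounded.subset_closedBall 0
    have h1 := integrableOn_sphere_integral (hint T)
    have h2 : IntegrableOn ((Iic T).indicator m) (Ioi 0) :=
      h1.congr_fun (hsl T) measurableSet_Ioi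
    rw [← integrable_indicator_iff measurableSet_Ioi] at h2
    have h3 := h2.integrableOn (s := K)
    refine h3.congr_fun ?_ hK.measurableSet
    intro r hr
    have hrT : r ≤ T := by
      have := hT hr
      rw [Metric.mem_closedBall, dist_zero_right] at this
      exact (le_abs_self r).trans this
    simp [indicator, hrT]
  · intro t ht
    rw [RE, ← integral_indicator (measurableSet_ellipsoid lam u t),
      integral_eq_jac_mul hlam (hf.1.indicator (measurableSet_ellipsoid lam u t)) u]
    congr 1
    have h1 : ∀ y, (ellipsoid lam u t).indicator f (ellipsoidMap d lam (WithLp.toLp 2 (u, y))) =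
        (Metric.closedBall (0 : E (d + 1)) t).indicator k y := by
      intro y
      simp only [indicator, ellipsoidMap_mem_ellipsoid hd hlam u y ht.le, Metric.mem_closedBall,
        dist_zero_right, hk]
    simp_rw [h1]
    rw [integral_polar (hint t), setIntegral_congr_fun measurableSet_Ioi (hsl t),
      intervalIntegral.integral_of_le ht.le, setIntegral_indicator measurableSet_Iic,
      setIntegral_indicator measurableSet_Ioi, Ioi_inter_Iic,
      inter_eq_self_of_subset_left Ioc_subset_Ioi_self]

/-- The data `t^{1-n} ∂ₜ R_E f(u, t)` are the integrals of `f` over the boundary of `E_{u,t}`,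
parametrized by the unit sphere. -/
lemma dataRE_eq_sphere_integral {d : ℕ} (hd : 1 ≤ d) {lam : ℝ} (hlam : 1 < lam)
    {f : E (d + 1) → ℂ} (hf : MemLp f 2) (u : E d) :
    ∀ᵐ t : ℝ, 0 < t → dataRE lam f u t =
      jac d lam * ∫ θ : Metric.sphere (0 : E (d + 1)) 1,
        f (ellipsoidMap d lam (WithLp.toLp 2 (u, t • (θ : E (d + 1)))))
          ∂(volume : Measure (E (d + 1))).toSphere := by
  obtain ⟨h1, h2⟩ := RE_eq_intervalIntegral hd hlam hf u
  filter_upwards [LocallyIntegrable.ae_hasDerivAt_integral h1] with t ht htpos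
  have h3 := (ht 0).const_mul (jac d lam : ℂ)
  have h4 := h3.congr_of_eventuallyEq
    (Filter.eventuallyEq_of_mem (Ioi_mem_nhds htpos) fun s hs => h2 s hs)
  rw [dataRE, h4.deriv, indicator_of_mem (mem_Ioi.2 htpos), Complex.real_smul]
  have : (t : ℂ) ≠ 0 := by exact_mod_cast htpos.ne'
  push_cast
  field_simp

/-- On each fibre over `u`, pairing the data with a function that is radial in `w` amounts to
pairing `f` with that function over all of `ℝᵈ⁺¹`. -/
lemma integral_radialLift_dataRE_fiber {d : ℕ} (hd : 1 ≤ d) {lam : ℝ} (hlam : 1 < lam)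
    {f : E (d + 1) → ℂ} (hf : MemLp f 2) (u : E d) {φ : E (d + 1) → ℂ} (hφ : MemLp φ 2)
    (hrad : ∀ w w', ‖w‖ = ‖w'‖ → φ w = φ w')
    (hint : Integrable fun w => radialLift (dataRE lam f) (WithLp.toLp 2 (u, w)) * φ w) :
    ∫ w, radialLift (dataRE lam f) (WithLp.toLp 2 (u, w)) * φ w =
      (volume : Measure (E (d + 1))).toSphere.real univ * jac d lam *
        ∫ y, f (ellipsoidMap d lam (WithLp.toLp 2 (u, y))) * φ y := by
  have hint2 : Integrable fun y => f (ellipsoidMap d lam (WithLp.toLp 2 (u, y))) * φ y :=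
    (memLp_comp_ellipsoidMap hlam hf u).integrable_mul hφ
  rw [integral_polar hint, integral_polar hint2, ← integral_const_mul]
  refine setIntegral_congr_ae measurableSet_Ioi ?_
  filter_upwards [dataRE_eq_sphere_integral hd hlam hf u] with r hr hr0
  have h0 : ∀ θ : Metric.sphere (0 : E (d + 1)) 1, ‖r • (θ : E (d + 1))‖ = r := by
    intro θ
    rw [norm_smul, norm_eq_of_mem_sphere, mul_one, Real.norm_of_nonneg (le_of_lt hr0)]
  obtain ⟨e⟩ : Nonempty (Metric.sphere (0 : E (d + 1)) 1) :=
    (NormedSpace.sphere_nonempty.2 zero_le_one).to_subtype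
  have h1 : ∀ θ : Metric.sphere (0 : E (d + 1)) 1,
      φ (r • (θ : E (d + 1))) = φ (r • (e : E (d + 1))) :=
    fun θ => hrad _ _ (by rw [h0, h0])
  have h2 : ∀ θ : Metric.sphere (0 : E (d + 1)) 1, radialLift (dataRE lam f)
      (WithLp.toLp 2 (u, r • (θ : E (d + 1)))) = dataRE lam f u r := by
    intro θ
    change dataRE lam f u ‖r • (θ : E (d + 1))‖ = _
    rw [h0]
  simp only [h1, h2, integral_mul_const, integral_const, Complex.real_smul]
  rw [hr hr0]
  ring

end

/-! ### The Fourier transform of pulled-back functions -/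

section

open scoped SchwartzMap

lemma integrable_comp_toLp {d : ℕ} {H : EProd d → ℂ} (hH : Integrable H) :
    Integrable (fun p : E d × E (d + 1) => H (WithLp.toLp 2 p))
      ((volume : Measure (E d)).prod (volume : Measure (E (d + 1)))) :=
  ((WithLp.volume_preserving_toLp (U := E d) (V := E (d + 1))).integrable_comp hH.1).2 hH

lemma integral_eprod {d : ℕ} {H : EProd d → ℂ} (hH : Integrable H) :
    ∫ z, H z = ∫ u : E d, ∫ w : E (d + 1), H (WithLp.toLp 2 (u, w)) := by
  rw [← (WithLp.volume_preserving_toLp (U := E d) (V := E (d + 1))).integral_comp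
    (MeasurableEquiv.toLp 2 (E d × E (d + 1))).measurableEmbedding]
  exact integral_prod _ (integrable_comp_toLp hH)

lemma lintegral_eprod {d : ℕ} {H : EProd d → ℝ≥0∞} (hH : AEMeasurable H) :
    ∫⁻ z, H z = ∫⁻ u : E d, ∫⁻ w : E (d + 1), H (WithLp.toLp 2 (u, w)) := by
  have hmp := WithLp.volume_preserving_toLp (U := E d) (V := E (d + 1))
  rw [← hmp.lintegral_comp_emb (MeasurableEquiv.toLp 2 (E d × E (d + 1))).measurableEmbedding]
  exact lintegral_prod _ (hH.comp_quasiMeasurePreserving hmp.quasiMeasurePreserving)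

/-- Decay of a Schwartz function on `ℝᵈ × ℝᵈ⁺¹`, separately in both variables. -/
lemma exists_enorm_schwartz_le {d : ℕ} (Φ : 𝓢(EProd d, ℂ)) :
    ∃ M : ℝ, 0 ≤ M ∧ ∀ (u : E d) (w : E (d + 1)),
      ‖Φ (WithLp.toLp 2 (u, w))‖ₑ ≤ ENNReal.ofReal ((1 + ‖u‖) ^ (-(d + 2 : ℝ))) *
        (ENNReal.ofReal M * ENNReal.ofReal ((1 + ‖w‖) ^ (-(d + 2 : ℝ)))) := by
  set m : ℕ × ℕ := (2 * (d + 2), 0)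
  set M : ℝ := 2 ^ m.1 * (Finset.Iic m).sup (fun m => SchwartzMap.seminorm ℂ m.1 m.2) Φ with hM
  have hM0 : 0 ≤ M := by positivity
  refine ⟨M, hM0, fun u w => ?_⟩
  set z : EProd d := WithLp.toLp 2 (u, w) with hz
  have h1 : (1 + ‖z‖) ^ (2 * (d + 2)) * ‖Φ z‖ ≤ M := by
    simpa using SchwartzMap.one_add_le_sup_seminorm_apply (𝕜 := ℂ) (m := m)
      (k := 2 * (d + 2)) (n := 0) le_rfl le_rfl Φ z
  have hu : ‖u‖ ≤ ‖z‖ := WithLp.norm_fst_le _ z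
  have hw : ‖w‖ ≤ ‖z‖ := WithLp.norm_snd_le _ z
  have h2 : (1 + ‖u‖) ^ (d + 2) * (1 + ‖w‖) ^ (d + 2) ≤ (1 + ‖z‖) ^ (2 * (d + 2)) := by
    rw [two_mul, pow_add _ (d + 2) (d + 2)]
    exact mul_le_mul (pow_le_pow_left₀ (by positivity) (by linarith) _)
      (pow_le_pow_left₀ (by positivity) (by linarith) _) (by positivity) (by positivity)
  have hp : ∀ a : ℝ, 0 ≤ a → (1 + a) ^ (-(d + 2 : ℝ)) = ((1 + a) ^ (d + 2))⁻¹ := by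
    intro a ha
    rw [Real.rpow_neg (by positivity)]
    norm_cast
  rw [← ofReal_norm, ← ENNReal.ofReal_mul hM0, ← ENNReal.ofReal_mul (by positivity)]
  apply ENNReal.ofReal_le_ofReal
  rw [hp _ (norm_nonneg u), hp _ (norm_nonneg w)]
  have h3 : (1 + ‖u‖) ^ (d + 2) * (1 + ‖w‖) ^ (d + 2) * ‖Φ z‖ ≤ M :=
    (mul_le_mul_of_nonneg_right h2 (norm_nonneg _)).trans h1
  have hu0 : (0 : ℝ) < (1 + ‖u‖) ^ (d + 2) := by positivity
  have hw0 : (0 : ℝ) < (1 + ‖w‖) ^ (d + 2) := by positivity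
  calc ‖Φ z‖ = ((1 + ‖u‖) ^ (d + 2))⁻¹ * ((1 + ‖u‖) ^ (d + 2) * (1 + ‖w‖) ^ (d + 2) * ‖Φ z‖ *
        ((1 + ‖w‖) ^ (d + 2))⁻¹) := by field_simp
    _ ≤ _ := by gcongr

/-- Pairing `k ∘ A`, for `A` the map `(u, y) ↦ (u, 0) + D y`, with a Schwartz function is bounded
by the `L²` norm of `k`. -/
lemma exists_lintegral_comp_ellipsoidMap_le {d : ℕ} {lam : ℝ} (hlam : 1 < lam)
    (Φ : 𝓢(EProd d, ℂ)) :
    ∃ C : ℝ≥0∞, C ≠ ∞ ∧ ∀ k : E (d + 1) → ℂ, Measurable k →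
      ∫⁻ z, ‖k (ellipsoidMap d lam z)‖ₑ * ‖Φ z‖ₑ ≤ C * eLpNorm k 2 := by
  obtain ⟨M, hM0, hM⟩ := exists_enorm_schwartz_le Φ
  set a : E d → ℝ≥0∞ := fun u => ENNReal.ofReal ((1 + ‖u‖) ^ (-(d + 2 : ℝ))) with ha
  set b : E (d + 1) → ℝ≥0∞ :=
    fun w => ENNReal.ofReal M * ENNReal.ofReal ((1 + ‖w‖) ^ (-(d + 2 : ℝ))) with hb
  have hbm : Measurable b := by fun_prop
  have hafin : ∫⁻ u, a u < ∞ := finite_integral_one_add_norm (by simp)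
  have hbfin : ∫⁻ w, b w < ∞ := by
    rw [lintegral_const_mul _ (by fun_prop)]
    exact ENNReal.mul_lt_top ENNReal.ofReal_lt_top (finite_integral_one_add_norm (by simp))
  have hbM : ∀ w, b w ≤ ENNReal.ofReal M := by
    intro w
    refine mul_le_of_le_one_right' (ENNReal.ofReal_le_one.2 ?_)
    exact Real.rpow_le_one_of_one_le_of_nonpos (by linarith [norm_nonneg w])
      (by have : (0 : ℝ) ≤ d := d.cast_nonneg
          linarith)
  have hb2 : ∫⁻ w, b w ^ (2 : ℝ) ≠ ∞ := by
    refine ne_of_lt (lt_of_le_of_lt (lintegral_mono (g := fun w => ENNReal.ofReal M * b w) ?_) ?_)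
    · intro w
      simp only [ENNReal.rpow_two, sq]
      gcongr
      exact hbM w
    · rw [lintegral_const_mul _ hbm]
      exact ENNReal.mul_lt_top ENNReal.ofReal_lt_top hbfin
  refine ⟨(∫⁻ u, a u) * (ENNReal.ofReal (jac d lam)⁻¹ ^ (1 / 2 : ℝ) *
    (∫⁻ w, b w ^ (2 : ℝ)) ^ (1 / 2 : ℝ)), ?_, fun k hk => ?_⟩
  · refine ENNReal.mul_ne_top hafin.ne (ENNReal.mul_ne_top ?_ ?_)
    · exact ENNReal.rpow_ne_top_of_nonneg (by norm_num) ENNReal.ofReal_ne_top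
    · exact ENNReal.rpow_ne_top_of_nonneg (by norm_num) hb2
  have hmeas : Measurable fun z => ‖k (ellipsoidMap d lam z)‖ₑ * ‖Φ z‖ₑ :=
    ((hk.comp (ellipsoidMap d lam).continuous.measurable).enorm).mul
      Φ.continuous.measurable.enorm
  rw [lintegral_eprod hmeas.aemeasurable,
    eLpNorm_eq_lintegral_rpow_enorm_toReal (by norm_num) (by norm_num)]
  simp only [ENNReal.toReal_ofNat]
  -- Cauchy–Schwarz in `w` for fixed `u`; the decay of `Φ` in `u` remains as the factor `a u`
  have hfib : ∀ u : E d, ∫⁻ w : E (d + 1), ‖k (ellipsoidMap d lam (WithLp.toLp 2 (u, w)))‖ₑ *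
      ‖Φ (WithLp.toLp 2 (u, w))‖ₑ ≤ a u * (((ENNReal.ofReal (jac d lam)⁻¹) ^ (1 / 2 : ℝ) *
        (∫⁻ x, ‖k x‖ₑ ^ (2 : ℝ)) ^ (1 / 2 : ℝ)) * (∫⁻ w, b w ^ (2 : ℝ)) ^ (1 / 2 : ℝ)) := by
    intro u
    calc ∫⁻ w : E (d + 1), ‖k (ellipsoidMap d lam (WithLp.toLp 2 (u, w)))‖ₑ *
          ‖Φ (WithLp.toLp 2 (u, w))‖ₑ
        ≤ ∫⁻ w : E (d + 1), a u * (‖k (ellipsoidMap d lam (WithLp.toLp 2 (u, w)))‖ₑ * b w) := by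
          refine lintegral_mono fun w => ?_
          rw [mul_left_comm]
          gcongr
          exact hM u w
      _ = a u * ∫⁻ w : E (d + 1), ‖k (ellipsoidMap d lam (WithLp.toLp 2 (u, w)))‖ₑ * b w :=
          lintegral_const_mul' _ _ ENNReal.ofReal_ne_top
      _ ≤ _ := by
          gcongr
          have hkm : Measurable fun w : E (d + 1) =>
              ‖k (ellipsoidMap d lam (WithLp.toLp 2 (u, w)))‖ₑ :=
            (hk.comp (measurable_ellipsoidMap_slice lam u)).enorm
          refine (ENNReal.lintegral_mul_le_Lp_mul_Lq volume Real.HolderConjugate.two_two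
            hkm.aemeasurable hbm.aemeasurable).trans (le_of_eq ?_)
          rw [← lintegral_map (f := fun x => ‖k x‖ₑ ^ (2 : ℝ))
            (g := fun w : E (d + 1) => ellipsoidMap d lam (WithLp.toLp 2 (u, w)))
            (hk.enorm.pow_const _) (measurable_ellipsoidMap_slice lam u),
            map_ellipsoidMap hlam, lintegral_smul_measure, smul_eq_mul,
            ENNReal.mul_rpow_of_nonneg _ _ (by norm_num : (0 : ℝ) ≤ 1 / 2)]
  refine (lintegral_mono hfib).trans (le_of_eq ?_)
  rw [lintegral_mul_const _ (by fun_prop)]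
  ring

/-- The adjoint of `(u, y) ↦ (u, 0) + D y` is `ξ ↦ (ξ', D ξ)`. -/
lemma adjoint_ellipsoidMap {d : ℕ} (lam : ℝ) (ξ : E (d + 1)) :
    (ellipsoidMap d lam).adjoint ξ =
      WithLp.toLp 2 (WithLp.toLp 2 fun i : Fin d => ξ i.castSucc, dilation d lam ξ) := by
  refine ext_inner_left ℝ fun z => ?_
  rw [ContinuousLinearMap.adjoint_inner_right, WithLp.prod_inner_apply]
  simp only [PiLp.inner_apply, Fin.sum_univ_castSucc, ellipsoidMap_castSucc, ellipsoidMap_last,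
    dilation, LinearMap.coe_mk, AddHom.coe_mk, RCLike.inner_apply, conj_trivial]
  rw [← add_assoc, ← Finset.sum_add_distrib]
  congr 1
  · refine Finset.sum_congr rfl fun i _ => ?_
    simp only [WithLp.ofLp_fst, WithLp.ofLp_snd]
    ring
  · simp only [WithLp.ofLp_snd]
    ring

lemma injective_adjoint_ellipsoidMap {d : ℕ} {lam : ℝ} (hlam : 1 < lam) :
    Function.Injective (ellipsoidMap d lam).adjoint := by
  intro x y hxy
  rw [adjoint_ellipsoidMap, adjoint_ellipsoidMap] at hxy
  have h1 : dilation d lam x = dilation d lam y := congrArg (fun z : EProd d => z.snd) hxy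
  ext i
  have := congrArg (fun v : E (d + 1) => v i) h1
  simpa [dilation, (semiaxis_pos hlam i).ne'] using this

/-- Composition of Schwartz functions on `ℝᵈ × ℝᵈ⁺¹` with `ξ ↦ (ξ', D ξ)`. -/
lemma exists_schwartz_comp_adjoint {d : ℕ} {lam : ℝ} (hlam : 1 < lam) (Ψ : 𝓢(EProd d, ℂ)) :
    ∃ Θ : 𝓢(E (d + 1), ℂ), ∀ ξ, Θ ξ = Ψ ((ellipsoidMap d lam).adjoint ξ) := by
  obtain ⟨K, -, hK⟩ := LinearMap.exists_antilipschitzWith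
    ((ellipsoidMap d lam).adjoint : E (d + 1) →ₗ[ℝ] EProd d)
    (LinearMap.ker_eq_bot.2 (injective_adjoint_ellipsoidMap hlam))
  exact ⟨SchwartzMap.compCLMOfAntilipschitz ℂ
    ((ellipsoidMap d lam).adjoint).hasTemperateGrowth hK Ψ, fun ξ => rfl⟩

/-- The Fourier transform on `L²` is symmetric for the bilinear pairing with Schwartz functions. -/
lemma integral_fourier_mul_schwartz {V : Type*} [NormedAddCommGroup V] [InnerProductSpace ℝ V]
    [FiniteDimensional ℝ V] [MeasurableSpace V] [BorelSpace V]
    (f : Lp ℂ 2 (volume : Measure V)) (Ψ : 𝓢(V, ℂ)) :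
    ∫ x, (𝓕 f : Lp ℂ 2 (volume : Measure V)) x * Ψ x = ∫ x, f x * (𝓕 Ψ) x := by
  have h := congrArg (fun T => T Ψ) (Lp.fourier_toTemperedDistribution_eq f)
  simp only [TemperedDistribution.fourier_apply, Lp.toTemperedDistribution_apply,
    smul_eq_mul] at h
  simpa only [mul_comm] using h.symm

/-- The pullback identity `∫ f(A z) Ψ̂(z) dz = ∫ f̂(ξ) Ψ(Aᵀ ξ) dξ` for a Schwartz function `f`. -/
lemma integral_comp_ellipsoidMap_mul_fourier_schwartz {d : ℕ} (lam : ℝ)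
    (f : 𝓢(E (d + 1), ℂ)) (Ψ : 𝓢(EProd d, ℂ)) :
    ∫ z, f (ellipsoidMap d lam z) * (𝓕 Ψ) z =
      ∫ ξ, (𝓕 f) ξ * Ψ ((ellipsoidMap d lam).adjoint ξ) := by
  set A := ellipsoidMap d lam
  -- Fubini for the kernel `exp (2πi ⟪ξ, A z⟫)`: the sign makes up for the minus sign in the kernel
  -- of `VectorFourier.fourierIntegral`
  let L : E (d + 1) →ₗ[ℝ] EProd d →ₗ[ℝ] ℝ :=
    -((innerₗ (E (d + 1))).compl₂ (A : EProd d →ₗ[ℝ] E (d + 1)))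
  have hL : ∀ ξ z, L ξ z = -inner ℝ ξ (A z) := fun ξ z => rfl
  have hLc : Continuous fun p : E (d + 1) × EProd d => L p.1 p.2 := by
    simp only [hL]
    fun_prop
  have h := VectorFourier.integral_fourierIntegral_smul_eq_flip (e := Real.fourierChar)
    (μ := (volume : Measure (E (d + 1)))) (ν := (volume : Measure (EProd d))) (L := L)
    Real.continuous_fourierChar hLc (f := fun x => (𝓕 f : 𝓢(E (d + 1), ℂ)) x)
    (g := fun z => (𝓕 Ψ : 𝓢(EProd d, ℂ)) z) (SchwartzMap.integrable _) (SchwartzMap.integrable _)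
  have h1 : ∀ z, VectorFourier.fourierIntegral Real.fourierChar volume L
      (fun x => (𝓕 f : 𝓢(E (d + 1), ℂ)) x) z = f (A z) := by
    intro z
    have : (𝓕⁻ (𝓕 f)) (A z) = f (A z) := by rw [FourierTransform.fourierInv_fourier_eq]
    rw [← this, SchwartzMap.fourierInv_coe, Real.fourierInv_eq]
    simp [VectorFourier.fourierIntegral, hL]
  have h2 : ∀ ξ, VectorFourier.fourierIntegral Real.fourierChar volume L.flip
      (fun z => (𝓕 Ψ : 𝓢(EProd d, ℂ)) z) ξ =
      Ψ (A.adjoint ξ) := by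
    intro ξ
    have : (𝓕⁻ (𝓕 Ψ)) (A.adjoint ξ) = Ψ (A.adjoint ξ) := by
      rw [FourierTransform.fourierInv_fourier_eq]
    rw [← this, SchwartzMap.fourierInv_coe, Real.fourierInv_eq]
    simp [VectorFourier.fourierIntegral, hL, ContinuousLinearMap.adjoint_inner_right,
      real_inner_comm]
  simpa only [h1, h2, smul_eq_mul] using h

/-- The pairing of `k ∘ A` with a Schwartz function is defined and Lipschitz on `L²`. -/
lemma exists_lipschitz_comp_ellipsoidMap {d : ℕ} {lam : ℝ} (hlam : 1 < lam)
    (Φ : 𝓢(EProd d, ℂ)) :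
    (∀ k : E (d + 1) → ℂ, Measurable k → MemLp k 2 →
      Integrable (fun z => k (ellipsoidMap d lam z) * Φ z)) ∧
    ∃ C : ℝ≥0∞, C ≠ ∞ ∧ ∀ k l : E (d + 1) → ℂ, Measurable k → Measurable l → MemLp k 2 →
      MemLp l 2 → edist (∫ z, k (ellipsoidMap d lam z) * Φ z)
        (∫ z, l (ellipsoidMap d lam z) * Φ z) ≤ C * eLpNorm (k - l) 2 := by
  obtain ⟨C, hC, hCb⟩ := exists_lintegral_comp_ellipsoidMap_le (d := d) hlam Φ
  have hInt : ∀ k : E (d + 1) → ℂ, Measurable k → MemLp k 2 →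
      Integrable (fun z => k (ellipsoidMap d lam z) * Φ z) := by
    intro k hk hk2
    refine ⟨((hk.comp (ellipsoidMap d lam).continuous.measurable).mul
      Φ.continuous.measurable).aestronglyMeasurable, ?_⟩
    rw [hasFiniteIntegral_iff_enorm]
    simp only [enorm_mul]
    exact (hCb k hk).trans_lt (ENNReal.mul_lt_top hC.lt_top hk2.2)
  refine ⟨hInt, C, hC, fun k l hk hl hk2 hl2 => ?_⟩
  rw [edist_eq_enorm_sub, ← integral_sub (hInt k hk hk2) (hInt l hl hl2)]
  refine (enorm_integral_le_lintegral_enorm _).trans ?_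
  refine le_trans (le_of_eq ?_) (hCb (k - l) (hk.sub hl))
  refine lintegral_congr fun z => ?_
  rw [← sub_mul, enorm_mul]
  rfl

/-- The pullback identity `∫ f(A z) Ψ̂(z) dz = ∫ f̂(ξ) Ψ(Aᵀ ξ) dξ` for the class in `L²` of a
Schwartz function. -/
lemma integral_comp_ellipsoidMap_mul_fourier_toLp {d : ℕ} {lam : ℝ} (hlam : 1 < lam)
    (h : 𝓢(E (d + 1), ℂ)) (Ψ : 𝓢(EProd d, ℂ)) (g : Lp ℂ 2 (volume : Measure (E (d + 1))))
    (hg : g = h.toLp 2) :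
    ∫ z, g (ellipsoidMap d lam z) * (𝓕 Ψ) z =
      ∫ ξ, (𝓕 g : Lp ℂ 2 (volume : Measure (E (d + 1)))) ξ *
        Ψ ((ellipsoidMap d lam).adjoint ξ) := by
  obtain ⟨-, C, hC, hedist⟩ := exists_lipschitz_comp_ellipsoidMap (d := d) hlam (𝓕 Ψ)
  have hae : g =ᵐ[volume] h := by rw [hg]; exact SchwartzMap.coeFn_toLp _ _ _
  have h1 : ∫ z, g (ellipsoidMap d lam z) * (𝓕 Ψ) z =
      ∫ z, h (ellipsoidMap d lam z) * (𝓕 Ψ) z := by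
    have h2 := hedist g h (Lp.stronglyMeasurable g).measurable h.continuous.measurable (Lp.memLp g)
      (h.memLp 2 volume)
    have h3 : eLpNorm (⇑g - ⇑h) 2 volume = 0 := by
      rw [eLpNorm_congr_ae (g := 0), eLpNorm_zero]
      filter_upwards [hae] with x hx
      simp [hx]
    rw [h3, mul_zero, nonpos_iff_eq_zero, edist_eq_zero] at h2
    exact h2
  rw [h1, integral_comp_ellipsoidMap_mul_fourier_schwartz, hg, SchwartzMap.toLp_fourier_eq]
  refine integral_congr_ae ?_
  filter_upwards [SchwartzMap.coeFn_toLp (𝓕 h) 2 volume] with ξ hξ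
  rw [hξ]

/-- The pullback identity `∫ f(A z) Ψ̂(z) dz = ∫ f̂(ξ) Ψ(Aᵀ ξ) dξ` for `f ∈ L²`, by density of the
Schwartz functions. -/
lemma integral_comp_ellipsoidMap_mul_fourier {d : ℕ} {lam : ℝ} (hlam : 1 < lam)
    (f : Lp ℂ 2 (volume : Measure (E (d + 1)))) (Ψ : 𝓢(EProd d, ℂ)) :
    ∫ z, f (ellipsoidMap d lam z) * (𝓕 Ψ) z =
      ∫ ξ, (𝓕 f : Lp ℂ 2 (volume : Measure (E (d + 1)))) ξ *
        Ψ ((ellipsoidMap d lam).adjoint ξ) := by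
  obtain ⟨-, C, hC, hedist⟩ := exists_lipschitz_comp_ellipsoidMap (d := d) hlam (𝓕 Ψ)
  have hcont : Continuous fun g : Lp ℂ 2 (volume : Measure (E (d + 1))) =>
      ∫ z, g (ellipsoidMap d lam z) * (𝓕 Ψ) z := by
    refine LipschitzWith.continuous (K := C.toNNReal) fun g h => ?_
    rw [ENNReal.coe_toNNReal hC, Lp.edist_def]
    exact hedist g h (Lp.stronglyMeasurable g).measurable (Lp.stronglyMeasurable h).measurable
      (Lp.memLp g) (Lp.memLp h)
  have hcont2 : Continuous fun g : Lp ℂ 2 (volume : Measure (E (d + 1))) =>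
      ∫ ξ, (𝓕 g : Lp ℂ 2 (volume : Measure (E (d + 1)))) ξ *
        Ψ ((ellipsoidMap d lam).adjoint ξ) := by
    obtain ⟨Θ, hΘ⟩ := exists_schwartz_comp_adjoint hlam Ψ
    have h1 : Continuous fun g : Lp ℂ 2 (volume : Measure (E (d + 1))) =>
        (Lp.toTemperedDistributionCLM ℂ volume 2 g) (𝓕 Θ) := by
      fun_prop
    simp only [← hΘ, integral_fourier_mul_schwartz]
    simpa only [Lp.toTemperedDistributionCLM_apply, Lp.toTemperedDistribution_apply, smul_eq_mul,
      mul_comm] using h1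
  exact DenseRange.induction_on
    (SchwartzMap.denseRange_toLpCLM (E := E (d + 1)) (F := ℂ) (p := 2) (μ := volume)
      ENNReal.ofNat_ne_top) f (isClosed_eq hcont hcont2)
    fun h => integral_comp_ellipsoidMap_mul_fourier_toLp hlam h Ψ _ rfl

end

/-! ### The Fourier transform of the lifted data -/

section

open scoped SchwartzMap

/-- The Fourier transform preserves radiality in the second variable. -/
lemma fourier_radial {d : ℕ} {Ψ : 𝓢(EProd d, ℂ)}
    (hΨ : ∀ (ξ : E d) (ζ ζ' : E (d + 1)), ‖ζ‖ = ‖ζ'‖ →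
      Ψ (WithLp.toLp 2 (ξ, ζ)) = Ψ (WithLp.toLp 2 (ξ, ζ')))
    (u : E d) (w w' : E (d + 1)) (hw : ‖w‖ = ‖w'‖) :
    (𝓕 Ψ) (WithLp.toLp 2 (u, w)) = (𝓕 Ψ) (WithLp.toLp 2 (u, w')) := by
  -- the reflection that exchanges `w` and `w'`
  set R : E (d + 1) ≃ₗᵢ[ℝ] E (d + 1) := (Submodule.span ℝ {w - w'})ᗮ.reflection with hR
  have hRw : R w = w' := Submodule.reflection_sub hw
  let A : EProd d ≃ₗᵢ[ℝ] EProd d :=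
    LinearIsometryEquiv.withLpProdCongr 2 (LinearIsometryEquiv.refl ℝ (E d)) R
  have h1 : (fun z => Ψ z) ∘ A = fun z => Ψ z := by
    ext z
    exact hΨ z.fst (R z.snd) z.snd (R.norm_map _)
  have h2 := Real.fourier_comp_linearIsometry A (fun z => Ψ z) (WithLp.toLp 2 (u, w))
  rw [h1] at h2
  have h3 : A (WithLp.toLp 2 (u, w)) = WithLp.toLp 2 (u, w') := by
    rw [← hRw]
    rfl
  rw [h3] at h2
  exact h2

/-- The Fourier transform of the lifted data is the pushforward of `f̂` under `ξ ↦ (ξ', D ξ)`,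
averaged over the spheres `|ζ| = const`: this is the identity tested against functions that are
radial in `ζ`. -/
lemma integral_fourier_radialLift {d : ℕ} (hd : 1 ≤ d) {lam : ℝ} (hlam : 1 < lam)
    (f : Lp ℂ 2 (volume : Measure (E (d + 1)))) (hg : MemL2Radial (dataRE lam f))
    {Ψ : 𝓢(EProd d, ℂ)}
    (hΨ : ∀ (ξ : E d) (ζ ζ' : E (d + 1)), ‖ζ‖ = ‖ζ'‖ →
      Ψ (WithLp.toLp 2 (ξ, ζ)) = Ψ (WithLp.toLp 2 (ξ, ζ'))) :
    ∫ z, (𝓕 (hg.memLp_radialLift.toLp (radialLift (dataRE lam f))) :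
        Lp ℂ 2 (volume : Measure (EProd d))) z * Ψ z =
      (volume : Measure (E (d + 1))).toSphere.real univ * jac d lam *
        ∫ ξ, (𝓕 f : Lp ℂ 2 (volume : Measure (E (d + 1)))) ξ *
          Ψ ((ellipsoidMap d lam).adjoint ξ) := by
  rw [integral_fourier_mul_schwartz, ← integral_comp_ellipsoidMap_mul_fourier hlam]
  set Φ : 𝓢(EProd d, ℂ) := 𝓕 Ψ with hΦ
  have hΦ2 : MemLp (fun z => Φ z) 2 := Φ.memLp 2 volume
  have hGint : Integrable fun z => radialLift (dataRE lam f) z * Φ z :=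
    hg.memLp_radialLift.integrable_mul hΦ2
  have hfint : Integrable fun z => f (ellipsoidMap d lam z) * Φ z :=
    (exists_lipschitz_comp_ellipsoidMap hlam Φ).1 f (Lp.stronglyMeasurable f).measurable
      (Lp.memLp f)
  have h1 : ∫ z, (hg.memLp_radialLift.toLp (radialLift (dataRE lam f)) : EProd d → ℂ) z * Φ z =
      ∫ z, radialLift (dataRE lam f) z * Φ z := by
    refine integral_congr_ae ?_
    filter_upwards [hg.memLp_radialLift.coeFn_toLp] with z hz
    rw [hz]
  rw [h1, integral_eprod hGint, integral_eprod hfint, ← integral_const_mul]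
  refine integral_congr_ae ?_
  -- almost every slice of `Φ` is square integrable, as `Φ` is
  have hΦsq : Integrable fun z => ((‖Φ z‖ ^ 2 : ℝ) : ℂ) :=
    ((memLp_two_iff_integrable_sq_norm hΦ2.1).1 hΦ2).ofReal
  filter_upwards [(integrable_comp_toLp hGint).prod_right_ae,
    (integrable_comp_toLp hΦsq).prod_right_ae] with u hu1 hu2
  have hΦc : Continuous fun w : E (d + 1) => Φ (WithLp.toLp 2 (u, w)) :=
    Φ.continuous.comp (by fun_prop)
  refine integral_radialLift_dataRE_fiber hd hlam (Lp.memLp f) u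
    (φ := fun w => Φ (WithLp.toLp 2 (u, w))) ?_ (fourier_radial hΨ u) hu1
  rw [memLp_two_iff_integrable_sq_norm hΦc.aestronglyMeasurable]
  simpa only [RCLike.re_to_complex, Complex.ofReal_re] using hu2.re

/-- The constant in the identity between the Fourier transforms of the data and of `f`. -/
def fourierConst (d : ℕ) (lam : ℝ) : ℝ :=
  (2 * Real.pi) ^ d * ((volume : Measure (E (d + 1))).toSphere.real univ * jac d lam)

lemma toSphere_real_pos (d : ℕ) : 0 < (volume : Measure (E (d + 1))).toSphere.real univ := by
  rw [measureReal_def, ENNReal.toReal_pos_iff]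
  refine ⟨?_, measure_lt_top _ _⟩
  rw [pos_iff_ne_zero, Ne, Measure.measure_univ_eq_zero]
  exact Measure.toSphere_ne_zero _

lemma fourierConst_pos {d : ℕ} {lam : ℝ} (hlam : 1 < lam) : 0 < fourierConst d lam :=
  mul_pos (by positivity) (mul_pos (toSphere_real_pos d) (jac_pos hlam))

/-- Scaling turns an integral against the Fourier transform `angFourier` into one against the
Fourier transform of Mathlib. -/
lemma integral_angFourier_mul {V : Type*} [NormedAddCommGroup V] [InnerProductSpace ℝ V]
    [FiniteDimensional ℝ V] [MeasurableSpace V] [BorelSpace V]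
    (f : Lp ℂ 2 (volume : Measure V)) (Ψ : V → ℂ) :
    ∫ ξ, angFourier f ξ * Ψ ξ = ((2 * Real.pi) ^ Module.finrank ℝ V : ℝ) *
      ∫ ξ, (𝓕 f : Lp ℂ 2 (volume : Measure V)) ξ * Ψ ((2 * Real.pi) • ξ) := by
  have h := Measure.integral_comp_smul (volume : Measure V)
    (fun ξ => (𝓕 f : Lp ℂ 2 (volume : Measure V)) ξ * Ψ ((2 * Real.pi) • ξ)) (2 * Real.pi)⁻¹
  have hpi : 2 * Real.pi ≠ 0 := by positivity
  simp only [smul_inv_smul₀ hpi] at h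
  rw [← Complex.real_smul, ← show |(((2 * Real.pi)⁻¹ ^ Module.finrank ℝ V)⁻¹)| =
    (2 * Real.pi) ^ Module.finrank ℝ V by rw [inv_pow, inv_inv, abs_of_pos (by positivity)]]
  exact h

/-- The tested identity between the Fourier transforms of the lifted data and of `f`, in the
normalization of `angFourier`. -/
lemma integral_angFourier_radialLift {d : ℕ} (hd : 1 ≤ d) {lam : ℝ} (hlam : 1 < lam)
    (f : Lp ℂ 2 (volume : Measure (E (d + 1)))) (hg : MemL2Radial (dataRE lam f))
    {Ψ : 𝓢(EProd d, ℂ)}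
    (hΨ : ∀ (ξ : E d) (ζ ζ' : E (d + 1)), ‖ζ‖ = ‖ζ'‖ →
      Ψ (WithLp.toLp 2 (ξ, ζ)) = Ψ (WithLp.toLp 2 (ξ, ζ'))) :
    ∫ z, angFourier (hg.memLp_radialLift.toLp (radialLift (dataRE lam f))) z * Ψ z =
      fourierConst d lam * ∫ ξ, angFourier f ξ * Ψ ((ellipsoidMap d lam).adjoint ξ) := by
  have hpi : 2 * Real.pi ≠ 0 := by positivity
  let Ψ' : 𝓢(EProd d, ℂ) := SchwartzMap.compCLMOfContinuousLinearEquiv ℂ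
    (ContinuousLinearEquiv.smulLeft (Units.mk0 (2 * Real.pi) hpi)) Ψ
  have hΨ' : ∀ z, Ψ' z = Ψ ((2 * Real.pi) • z) := fun z => rfl
  have hrad : ∀ (ξ : E d) (ζ ζ' : E (d + 1)), ‖ζ‖ = ‖ζ'‖ →
      Ψ' (WithLp.toLp 2 (ξ, ζ)) = Ψ' (WithLp.toLp 2 (ξ, ζ')) := by
    intro ξ ζ ζ' h
    exact hΨ _ _ _ (by simp [norm_smul, h])
  rw [integral_angFourier_mul, integral_angFourier_mul]
  have h := integral_fourier_radialLift hd hlam f hg hrad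
  simp only [hΨ', ← map_smul] at h
  rw [h, fourierConst]
  have hr : Module.finrank ℝ (EProd d) = d + (d + 1) := by
    rw [(WithLp.linearEquiv 2 ℝ (E d × E (d + 1))).finrank_eq, Module.finrank_prod]
    simp
  have hr2 : Module.finrank ℝ (E (d + 1)) = d + 1 := by simp
  rw [hr, hr2, pow_add]
  push_cast
  ring

end

/-! ### Coordinates on frequency space and test functions -/

section

open scoped SchwartzMap

/-- The point `(x', xₙ)` of `ℝᵈ⁺¹`. -/
def join {d : ℕ} (p : E d × ℝ) : E (d + 1) :=
  WithLp.toLp 2 (Fin.snoc (α := fun _ => ℝ) (fun i => p.1 i) p.2)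

@[simp] lemma join_castSucc {d : ℕ} (p : E d × ℝ) (i : Fin d) : join p i.castSucc = p.1 i := by
  simp [join]

@[simp] lemma join_last {d : ℕ} (p : E d × ℝ) : join p (Fin.last d) = p.2 := by
  simp [join]

lemma measurePreserving_join (d : ℕ) :
    MeasurePreserving (join : E d × ℝ → E (d + 1)) volume volume := by
  have h1 : MeasurePreserving (Prod.map (WithLp.ofLp : E d → Fin d → ℝ) (id : ℝ → ℝ)) :=
    (PiLp.volume_preserving_ofLp (Fin d)).prod (MeasurePreserving.id volume)
  have h2 : MeasurePreserving (Prod.swap : (Fin d → ℝ) × ℝ → ℝ × (Fin d → ℝ)) :=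
    Measure.measurePreserving_swap
  have h3 := (volume_preserving_piFinSuccAbove (fun _ : Fin (d + 1) => ℝ) (Fin.last d)).symm
  have h4 := (PiLp.volume_preserving_toLp (Fin (d + 1))).comp (h3.comp (h2.comp h1))
  have h5 : (join : E d × ℝ → E (d + 1)) = WithLp.toLp 2 ∘
      (MeasurableEquiv.piFinSuccAbove (fun _ : Fin (d + 1) => ℝ) (Fin.last d)).symm ∘
        Prod.swap ∘ Prod.map WithLp.ofLp id := by
    funext p
    ext i
    induction i using Fin.lastCases <;> simp [join, MeasurableEquiv.piFinSuccAbove]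
  rw [h5]
  exact h4

lemma norm_join_sq {d : ℕ} (p : E d × ℝ) : ‖join p‖ ^ 2 = ‖p.1‖ ^ 2 + p.2 ^ 2 := by
  rw [EuclideanSpace.real_norm_sq_eq, EuclideanSpace.real_norm_sq_eq, Fin.sum_univ_castSucc]
  simp

lemma integral_join {d : ℕ} {H : E (d + 1) → ℂ} (hH : AEStronglyMeasurable H) :
    ∫ p : E d × ℝ, H (join p) = ∫ ξ, H ξ := by
  rw [← integral_map (f := H) (measurePreserving_join d).measurable.aemeasurable
    (by rw [(measurePreserving_join d).map_eq]; exact hH), (measurePreserving_join d).map_eq]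

/-- The length of the last semi-axis of `E_{0,1}`. -/
def lastAxis (d : ℕ) (lam : ℝ) : ℝ := semiaxis lam (Fin.last d)

lemma lastAxis_pos {d : ℕ} {lam : ℝ} (hlam : 1 < lam) : 0 < lastAxis d lam := semiaxis_pos hlam _

/-- The contribution of `ξ'` to `|D ξ|²`. -/
def tangentialSq {d : ℕ} (lam : ℝ) (ξ : E d) : ℝ :=
  ∑ i : Fin d, (semiaxis lam i.castSucc * ξ i) ^ 2

lemma tangentialSq_nonneg {d : ℕ} (lam : ℝ) (ξ : E d) : 0 ≤ tangentialSq lam ξ :=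
  Finset.sum_nonneg fun _ _ => sq_nonneg _

lemma contDiff_tangentialSq {d : ℕ} (lam : ℝ) {n : WithTop ℕ∞} :
    ContDiff ℝ n (tangentialSq lam : E d → ℝ) := by
  unfold tangentialSq
  fun_prop

lemma norm_dilation_sq {d : ℕ} (lam : ℝ) (ξ : E (d + 1)) :
    ‖dilation d lam ξ‖ ^ 2 =
      tangentialSq lam (WithLp.toLp 2 fun i : Fin d => ξ i.castSucc) +
        (lastAxis d lam * ξ (Fin.last d)) ^ 2 := by
  rw [EuclideanSpace.real_norm_sq_eq, Fin.sum_univ_castSucc]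
  rfl

/-- The length of `D ξ` for `ξ = (ξ', κ)`, as a function of `ξ'` and `κ`. -/
def dilationNorm {d : ℕ} (lam : ℝ) (ξ : E d) (κ : ℝ) : ℝ :=
  √((lastAxis d lam * κ) ^ 2 + tangentialSq lam ξ)

lemma continuous_dilationNorm {d : ℕ} (lam : ℝ) :
    Continuous fun p : E d × ℝ => dilationNorm lam p.1 p.2 := by
  unfold dilationNorm
  have := (contDiff_tangentialSq (d := d) lam (n := 0)).continuous
  fun_prop

lemma sq_dilationNorm {d : ℕ} (lam : ℝ) (ξ : E d) (κ : ℝ) :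
    dilationNorm lam ξ κ ^ 2 = (lastAxis d lam * κ) ^ 2 + tangentialSq lam ξ :=
  Real.sq_sqrt (add_nonneg (sq_nonneg _) (tangentialSq_nonneg lam ξ))

lemma dilationNorm_pos {d : ℕ} {lam : ℝ} (hlam : 1 < lam) (ξ : E d) {κ : ℝ} (hκ : 0 < κ) :
    0 < dilationNorm lam ξ κ := by
  have h1 := lastAxis_pos (d := d) hlam
  have h2 := tangentialSq_nonneg lam ξ
  exact Real.sqrt_pos.2 (by positivity)

lemma hasDerivAt_dilationNorm {d : ℕ} {lam : ℝ} (hlam : 1 < lam) (ξ : E d) {κ : ℝ} (hκ : 0 < κ) :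
    HasDerivAt (dilationNorm lam ξ) (lastAxis d lam ^ 2 * κ / dilationNorm lam ξ κ) κ := by
  have hpos := dilationNorm_pos hlam ξ hκ
  have h1 : HasDerivAt (fun κ : ℝ => (lastAxis d lam * κ) ^ 2 + tangentialSq lam ξ)
      (2 * (lastAxis d lam * κ) * lastAxis d lam) κ := by
    have := (((hasDerivAt_id κ).const_mul (lastAxis d lam)).pow 2).add_const (tangentialSq lam ξ)
    simpa using this
  have h2 := h1.sqrt (Real.sqrt_pos.1 hpos).ne'
  refine h2.congr_deriv ?_
  change _ / (2 * dilationNorm lam ξ κ) = _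
  field_simp

lemma injOn_dilationNorm {d : ℕ} {lam : ℝ} (hlam : 1 < lam) (ξ : E d) :
    InjOn (dilationNorm lam ξ) (Ioi 0) := by
  intro x hx y hy hxy
  have h1 := congrArg (· ^ 2) hxy
  simp only [sq_dilationNorm] at h1
  have h2 := lastAxis_pos (d := d) hlam
  have h3 : lastAxis d lam * x = lastAxis d lam * y := by
    refine (sq_eq_sq₀ ?_ ?_).1 (add_right_cancel h1)
    · exact mul_nonneg h2.le (le_of_lt hx)
    · exact mul_nonneg h2.le (le_of_lt hy)
  exact mul_left_cancel₀ h2.ne' h3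

lemma image_dilationNorm {d : ℕ} {lam : ℝ} (hlam : 1 < lam) (ξ : E d) :
    dilationNorm lam ξ '' Ioi 0 = Ioi √(tangentialSq lam ξ) := by
  have h2 := lastAxis_pos (d := d) hlam
  have hq := tangentialSq_nonneg lam ξ
  ext η
  constructor
  · rintro ⟨κ, hκ, rfl⟩
    have hκ : 0 < κ := hκ
    exact Real.sqrt_lt_sqrt hq (lt_add_of_pos_left _ (by positivity))
  · intro hη
    have hη0 : 0 < η := (Real.sqrt_nonneg _).trans_lt hη
    have h3 : tangentialSq lam ξ < η ^ 2 := (Real.sqrt_lt' hη0).1 hη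
    have h4 : 0 < √(η ^ 2 - tangentialSq lam ξ) := Real.sqrt_pos.2 (by linarith)
    refine ⟨√(η ^ 2 - tangentialSq lam ξ) / lastAxis d lam, div_pos h4 h2, ?_⟩
    rw [dilationNorm, mul_div_cancel₀ _ h2.ne', Real.sq_sqrt (by linarith), sub_add_cancel,
      Real.sqrt_sq hη0.le]

/-- The Jacobian of `κ ↦ |D (ξ', κ)|`. -/
def dilationNormDeriv {d : ℕ} (lam : ℝ) (ξ : E d) (κ : ℝ) : ℝ :=
  lastAxis d lam ^ 2 * κ / dilationNorm lam ξ κ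

lemma dilationNormDeriv_nonneg {d : ℕ} (lam : ℝ) (ξ : E d) {κ : ℝ} (hκ : 0 < κ) :
    0 ≤ dilationNormDeriv lam ξ κ :=
  div_nonneg (mul_nonneg (sq_nonneg _) hκ.le) (Real.sqrt_nonneg _)

lemma lintegral_dilationNorm {d : ℕ} {lam : ℝ} (hlam : 1 < lam) (ξ : E d) (G : ℝ → ℝ≥0∞) :
    ∫⁻ κ in Ioi 0, ENNReal.ofReal (dilationNormDeriv lam ξ κ) * G (dilationNorm lam ξ κ) =
      ∫⁻ η in Ioi √(tangentialSq lam ξ), G η := by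
  rw [← image_dilationNorm hlam, lintegral_image_eq_lintegral_abs_deriv_mul measurableSet_Ioi
    (fun κ hκ => (hasDerivAt_dilationNorm hlam ξ hκ).hasDerivWithinAt) (injOn_dilationNorm hlam ξ)]
  refine setLIntegral_congr_fun measurableSet_Ioi fun κ hκ => ?_
  rw [← dilationNormDeriv, abs_of_nonneg (dilationNormDeriv_nonneg lam ξ hκ)]

lemma integral_dilationNorm {d : ℕ} {lam : ℝ} (hlam : 1 < lam) (ξ : E d) (G : ℝ → ℂ) :
    ∫ κ in Ioi 0, dilationNormDeriv lam ξ κ * G (dilationNorm lam ξ κ) =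
      ∫ η in Ioi √(tangentialSq lam ξ), G η := by
  rw [← image_dilationNorm hlam, integral_image_eq_integral_abs_deriv_smul measurableSet_Ioi
    (fun κ hκ => (hasDerivAt_dilationNorm hlam ξ hκ).hasDerivWithinAt) (injOn_dilationNorm hlam ξ)]
  refine setIntegral_congr_fun measurableSet_Ioi fun κ hκ => ?_
  rw [← dilationNormDeriv, abs_of_nonneg (dilationNormDeriv_nonneg lam ξ hκ), Complex.real_smul]

/-- The function `(ξ, ζ) ↦ χ(ξ, √(|ζ|² - q(ξ)) / ν)`, where `q(ξ)` is the contribution of `ξ` to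
`|D (ξ, κ)|²` and `ν` is the last semi-axis. It is radial in `ζ`, and its value at `(ξ', D ξ)` is
`χ(ξ', |ξₙ|)`. Outside the range of the square root it takes the value `χ(ξ, 0)`. -/
def radialTest {d : ℕ} (lam : ℝ) (χ : E d × ℝ → ℝ) (z : EProd d) : ℂ :=
  χ (z.fst, √(‖z.snd‖ ^ 2 - tangentialSq lam z.fst) / lastAxis d lam)

variable {d : ℕ} {lam : ℝ} {χ : E d × ℝ → ℝ}

lemma eq_zero_of_tsupport_subset (hχU : tsupport χ ⊆ {p | 0 < p.2}) {p : E d × ℝ}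
    (hp : p.2 ≤ 0) : χ p = 0 := by
  by_contra h
  exact absurd (hχU (subset_tsupport _ h)) (not_lt.2 hp)

open scoped ContDiff in
/-- The square root is harmless, as `χ(ξ, κ)` vanishes for small `κ`. -/
lemma contDiff_radialTest (lam : ℝ) (hχ : ContDiff ℝ ∞ χ) (hχU : tsupport χ ⊆ {p | 0 < p.2}) :
    ContDiff ℝ ∞ (radialTest lam χ) := by
  have h1 : ContDiff ℝ ∞ fun p : E d × ℝ => χ (p.1, √p.2 / lastAxis d lam) := by
    rw [contDiff_iff_contDiffAt]
    intro p
    rcases lt_or_ge 0 p.2 with hp | hp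
    · have h2 : ContDiffAt ℝ ∞ (fun p : E d × ℝ => √p.2) p :=
        contDiffAt_snd.sqrt hp.ne'
      exact hχ.contDiffAt.comp p (contDiffAt_fst.prodMk (h2.div_const _))
    · have h2 : (p.1, √p.2 / lastAxis d lam) ∉ tsupport χ := by
        intro h
        have := hχU h
        simp [Real.sqrt_eq_zero_of_nonpos hp] at this
      have h3 : ∀ᶠ r : E d × ℝ in nhds p, (r.1, √r.2 / lastAxis d lam) ∈ (tsupport χ)ᶜ := by
        have hc : Continuous fun r : E d × ℝ => (r.1, √r.2 / lastAxis d lam) := by fun_prop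
        exact hc.continuousAt.eventually_mem ((isClosed_tsupport χ).isOpen_compl.mem_nhds h2)
      refine (contDiffAt_const (c := (0 : ℝ))).congr_of_eventuallyEq ?_
      filter_upwards [h3] with r hr
      exact image_eq_zero_of_notMem_tsupport hr
  have h2 : ContDiff ℝ ∞ fun z : EProd d =>
      ((z.fst, ‖z.snd‖ ^ 2 - tangentialSq lam z.fst) : E d × ℝ) := by
    have hf : ContDiff ℝ ∞ fun z : EProd d => z.fst :=
      (WithLp.fstL 2 ℝ (E d) (E (d + 1))).contDiff
    have hs : ContDiff ℝ ∞ fun z : EProd d => z.snd :=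
      (WithLp.sndL 2 ℝ (E d) (E (d + 1))).contDiff
    exact hf.prodMk ((hs.norm_sq ℝ).sub ((contDiff_tangentialSq lam).comp hf))
  exact Complex.ofRealCLM.contDiff.comp (h1.comp h2)

lemma hasCompactSupport_radialTest (hlam : 1 < lam) (hχc : HasCompactSupport χ)
    (hχU : tsupport χ ⊆ {p | 0 < p.2}) : HasCompactSupport (radialTest lam χ) := by
  have hν := lastAxis_pos (d := d) hlam
  have hcont : Continuous fun p : E d × ℝ => ‖p.1‖ ^ 2 + dilationNorm lam p.1 p.2 ^ 2 := by
    have := continuous_dilationNorm (d := d) lam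
    fun_prop
  -- where the function does not vanish, `|ξ|² + |ζ|²` is a value of this continuous function on the
  -- compact support of `χ`
  obtain ⟨B, hB⟩ := (hχc.isCompact.image hcont).isBounded.subset_closedBall 0
  refine HasCompactSupport.intro (isCompact_closedBall (0 : EProd d) √B) fun z hz => ?_
  by_contra h
  set κ := √(‖z.snd‖ ^ 2 - tangentialSq lam z.fst) / lastAxis d lam with hκ
  have h1 : χ (z.fst, κ) ≠ 0 := fun h0 => h (by simp [radialTest, ← hκ, h0])
  have hmem : (z.fst, κ) ∈ tsupport χ := subset_tsupport _ h1
  have hκ0 : 0 < κ := hχU hmem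
  have hpos : 0 < ‖z.snd‖ ^ 2 - tangentialSq lam z.fst :=
    Real.sqrt_pos.1 (by rw [hκ] at hκ0; exact (div_pos_iff_of_pos_right hν).1 hκ0)
  have h2 : dilationNorm lam z.fst κ ^ 2 = ‖z.snd‖ ^ 2 := by
    rw [sq_dilationNorm, hκ, mul_div_cancel₀ _ hν.ne', Real.sq_sqrt hpos.le]
    ring
  have h3 := hB (mem_image_of_mem _ hmem)
  simp only [h2, Metric.mem_closedBall, dist_zero_right] at h3
  rw [Real.norm_of_nonneg (by positivity), ← WithLp.prod_norm_sq_eq_of_L2] at h3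
  exact hz (by simpa using Real.le_sqrt_of_sq_le h3)

lemma radialTest_radial (χ : E d × ℝ → ℝ) (ξ : E d) (ζ ζ' : E (d + 1)) (h : ‖ζ‖ = ‖ζ'‖) :
    radialTest lam χ (WithLp.toLp 2 (ξ, ζ)) = radialTest lam χ (WithLp.toLp 2 (ξ, ζ')) := by
  change (χ (ξ, √(‖ζ‖ ^ 2 - tangentialSq lam ξ) / lastAxis d lam) : ℂ) =
    χ (ξ, √(‖ζ'‖ ^ 2 - tangentialSq lam ξ) / lastAxis d lam)
  rw [h]

lemma radialTest_adjoint (hlam : 1 < lam) (χ : E d × ℝ → ℝ) (ξ : E (d + 1)) :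
    radialTest lam χ ((ellipsoidMap d lam).adjoint ξ) =
      χ (WithLp.toLp 2 fun i : Fin d => ξ i.castSucc, |ξ (Fin.last d)|) := by
  have hν := lastAxis_pos (d := d) hlam
  rw [adjoint_ellipsoidMap]
  set ξ' : E d := WithLp.toLp 2 fun i : Fin d => ξ i.castSucc with hξ'
  change (χ (ξ', √(‖dilation d lam ξ‖ ^ 2 - tangentialSq lam ξ') / lastAxis d lam) : ℂ) = _
  rw [norm_dilation_sq, ← hξ', add_sub_cancel_left, Real.sqrt_sq_eq_abs, abs_mul, abs_of_pos hν,
    mul_div_cancel_left₀ _ hν.ne']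

lemma radialTest_dilationNorm (hlam : 1 < lam) (χ : E d × ℝ → ℝ) (ξ : E d) {κ : ℝ} (hκ : 0 < κ)
    {w : E (d + 1)} (hw : ‖w‖ = dilationNorm lam ξ κ) :
    radialTest lam χ (WithLp.toLp 2 (ξ, w)) = χ (ξ, κ) := by
  have hν := lastAxis_pos (d := d) hlam
  change (χ (ξ, √(‖w‖ ^ 2 - tangentialSq lam ξ) / lastAxis d lam) : ℂ) = _
  rw [hw, sq_dilationNorm, add_sub_cancel_right, Real.sqrt_sq (by positivity),
    mul_div_cancel_left₀ _ hν.ne']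

end

/-! ### Evenness and the two sides of the tested identity -/

section

open scoped SchwartzMap

lemma stronglyMeasurable_angFourier {V : Type*} [NormedAddCommGroup V] [InnerProductSpace ℝ V]
    [FiniteDimensional ℝ V] [MeasurableSpace V] [BorelSpace V]
    (f : Lp ℂ 2 (volume : Measure V)) : StronglyMeasurable (angFourier f) :=
  (Lp.stronglyMeasurable _).comp_measurable (measurable_const_smul _)

lemma quasiMeasurePreserving_const_smul {V : Type*} [NormedAddCommGroup V] [NormedSpace ℝ V]
    [FiniteDimensional ℝ V] [MeasurableSpace V] [BorelSpace V] (μ : Measure V) [μ.IsAddHaarMeasure]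
    {c : ℝ} (hc : c ≠ 0) : Measure.QuasiMeasurePreserving (fun x : V => c • x) μ μ := by
  refine ⟨measurable_const_smul c, ?_⟩
  rw [Measure.map_addHaar_smul μ hc]
  exact Measure.smul_absolutelyContinuous

lemma memLp_angFourier {V : Type*} [NormedAddCommGroup V] [InnerProductSpace ℝ V]
    [FiniteDimensional ℝ V] [MeasurableSpace V] [BorelSpace V]
    (f : Lp ℂ 2 (volume : Measure V)) : MemLp (angFourier f) 2 := by
  have hc : (2 * Real.pi)⁻¹ ≠ 0 := by positivity
  refine MemLp.comp_of_map (f := fun x : V => (2 * Real.pi)⁻¹ • x) (μ := volume)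
    (g := (𝓕 f : Lp ℂ 2 (volume : Measure V))) ?_ (by fun_prop)
  rw [Measure.map_addHaar_smul volume hc]
  exact (Lp.memLp _).smul_measure ENNReal.ofReal_ne_top

open scoped ContDiff in
/-- The Fourier transform on `L²` preserves invariance under a linear isometry. -/
lemma fourier_comp_linearIsometryEquiv_ae {V : Type*} [NormedAddCommGroup V]
    [InnerProductSpace ℝ V] [FiniteDimensional ℝ V] [MeasurableSpace V] [BorelSpace V]
    (R : V ≃ₗᵢ[ℝ] V)
    (f : Lp ℂ 2 (volume : Measure V)) (hf : ∀ᵐ x, f (R x) = f x) :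
    ∀ᵐ ξ, (𝓕 f : Lp ℂ 2 (volume : Measure V)) (R ξ) = (𝓕 f : Lp ℂ 2 (volume : Measure V)) ξ := by
  have hR := R.measurePreserving
  have hemb := R.toHomeomorph.measurableEmbedding
  set F : Lp ℂ 2 (volume : Measure V) := 𝓕 f with hF
  have hloc : LocallyIntegrable F volume := (Lp.memLp F).locallyIntegrable (by norm_num)
  have hloc2 : LocallyIntegrable (fun ξ => F (R ξ)) volume :=
    ((Lp.memLp F).comp_measurePreserving hR).locallyIntegrable (by norm_num)
  refine ae_eq_of_integral_contDiff_smul_eq hloc2 hloc fun g hg hgc => ?_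
  let Ψ : 𝓢(V, ℂ) := HasCompactSupport.toSchwartzMap (f := fun x => (g x : ℂ))
    (hgc.comp_left (g := fun r : ℝ => (r : ℂ)) Complex.ofReal_zero)
    (Complex.ofRealCLM.contDiff.comp hg)
  have hΨ : ∀ x, Ψ x = g x := fun x => rfl
  let Ψ' : 𝓢(V, ℂ) := SchwartzMap.compCLMOfContinuousLinearEquiv ℂ
    R.symm.toContinuousLinearEquiv Ψ
  have hΨ' : ∀ x, Ψ' x = Ψ (R.symm x) := fun x => rfl
  have h𝓕 : ∀ x, (𝓕 Ψ') x = (𝓕 Ψ) (R.symm x) :=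
    fun x => Real.fourier_comp_linearIsometry R.symm (fun z => Ψ z) x
  simp only [Complex.real_smul, ← hΨ]
  calc ∫ x, Ψ x * F (R x) = ∫ x, (fun y => F y * Ψ' y) (R x) := by
        simp only [hΨ', R.symm_apply_apply, mul_comm]
    _ = ∫ y, F y * Ψ' y := hR.integral_comp hemb fun y => F y * Ψ' y
    _ = ∫ y, f y * (𝓕 Ψ') y := integral_fourier_mul_schwartz f Ψ'
    _ = ∫ x, (fun y => f y * (𝓕 Ψ') y) (R x) :=
        (hR.integral_comp hemb fun y => f y * (𝓕 Ψ') y).symm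
    _ = ∫ x, f x * (𝓕 Ψ) x := by
        refine integral_congr_ae ?_
        filter_upwards [hf] with x hx
        simp only [h𝓕, R.symm_apply_apply, hx]
    _ = ∫ x, F x * Ψ x := (integral_fourier_mul_schwartz f Ψ).symm
    _ = ∫ x, Ψ x * F x := by simp only [mul_comm]

/-- The reflection in the hyperplane of centres, as a linear isometry. -/
def reflectEquiv (d : ℕ) : E (d + 1) ≃ₗᵢ[ℝ] E (d + 1) :=
  LinearIsometryEquiv.piLpCongrRight 2 fun i : Fin (d + 1) =>
    if i = Fin.last d then LinearIsometryEquiv.neg ℝ else LinearIsometryEquiv.refl ℝ ℝ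

lemma reflectEquiv_apply {d : ℕ} (x : E (d + 1)) : reflectEquiv d x = reflect x := by
  ext i
  simp only [reflectEquiv, LinearIsometryEquiv.piLpCongrRight_apply, reflect]
  split_ifs <;> simp

lemma reflect_castSucc {d : ℕ} (x : E (d + 1)) (i : Fin d) :
    reflect x i.castSucc = x i.castSucc := by
  simp [reflect, (Fin.castSucc_lt_last i).ne]

lemma reflect_last {d : ℕ} (x : E (d + 1)) : reflect x (Fin.last d) = -x (Fin.last d) := by
  simp [reflect]

lemma measurePreserving_reflect (d : ℕ) :
    MeasurePreserving (reflect : E (d + 1) → E (d + 1)) volume volume := by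
  have : (reflect : E (d + 1) → E (d + 1)) = reflectEquiv d :=
    funext fun x => (reflectEquiv_apply x).symm
  rw [this]
  exact (reflectEquiv d).measurePreserving

lemma measurableEmbedding_reflect (d : ℕ) :
    MeasurableEmbedding (reflect : E (d + 1) → E (d + 1)) := by
  have : (reflect : E (d + 1) → E (d + 1)) = reflectEquiv d :=
    funext fun x => (reflectEquiv_apply x).symm
  rw [this]
  exact (reflectEquiv d).toHomeomorph.measurableEmbedding

lemma angFourier_reflect_ae {d : ℕ} {f : Lp ℂ 2 (volume : Measure (E (d + 1)))}
    (hf : ∀ᵐ x : E (d + 1), f (reflect x) = f x) :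
    ∀ᵐ ξ, angFourier f (reflect ξ) = angFourier f ξ := by
  have h1 := fourier_comp_linearIsometryEquiv_ae (reflectEquiv d) f
    (by simpa only [reflectEquiv_apply] using hf)
  have hc : (2 * Real.pi)⁻¹ ≠ 0 := by positivity
  have h2 := (quasiMeasurePreserving_const_smul (volume : Measure (E (d + 1))) hc).ae h1
  filter_upwards [h2] with ξ hξ
  rw [map_smul, reflectEquiv_apply] at hξ
  exact hξ

lemma stronglyMeasurable_tilde {d : ℕ} {g : E d → ℝ → ℂ} (hg : MemL2Radial g) :
    StronglyMeasurable fun p : E d × ℝ => tilde hg p.1 p.2 := by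
  unfold tilde average
  refine StronglyMeasurable.integral_prod_right (f := fun (p : E d × ℝ)
    (θ : Metric.sphere (0 : E (d + 1)) 1) => angFourier (hg.memLp_radialLift.toLp (radialLift g))
      (WithLp.toLp 2 (p.1, p.2 • (θ : E (d + 1))))) ?_
  exact (stronglyMeasurable_angFourier _).comp_measurable (by fun_prop)

lemma sphere_integral_angFourier {d : ℕ} {g : E d → ℝ → ℂ} (hg : MemL2Radial g) (ξ : E d) (η : ℝ) :
    ∫ θ : Metric.sphere (0 : E (d + 1)) 1,
      angFourier (hg.memLp_radialLift.toLp (radialLift g))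
        (WithLp.toLp 2 (ξ, η • (θ : E (d + 1)))) ∂(volume : Measure (E (d + 1))).toSphere =
      (volume : Measure (E (d + 1))).toSphere.real univ * tilde hg ξ η := by
  rw [tilde, average_eq, Complex.real_smul, ← mul_assoc, Complex.ofReal_inv,
    mul_inv_cancel₀ (by exact_mod_cast (toSphere_real_pos d).ne'), one_mul]

variable {d : ℕ} {lam : ℝ} {χ : E d × ℝ → ℝ}

open scoped ContDiff in
/-- On the side of the data, polar coordinates in `ζ` and the substitution `η = |D (ξ, κ)|` turn the
tested identity into an integral against `χ`. -/
lemma integral_angFourier_mul_radialTest {g : E d → ℝ → ℂ} (hg : MemL2Radial g) (hlam : 1 < lam)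
    (hχ : ContDiff ℝ ∞ χ) (hχc : HasCompactSupport χ) (hχU : tsupport χ ⊆ {p | 0 < p.2}) :
    ∫ z, angFourier (hg.memLp_radialLift.toLp (radialLift g)) z * radialTest lam χ z =
      (volume : Measure (E (d + 1))).toSphere.real univ * ∫ ξ : E d, ∫ κ in Ioi (0 : ℝ),
        dilationNormDeriv lam ξ κ * (dilationNorm lam ξ κ ^ d * tilde hg ξ (dilationNorm lam ξ κ) *
          χ (ξ, κ)) := by
  set G := hg.memLp_radialLift.toLp (radialLift g)
  have hΨc : Continuous (radialTest lam χ) := (contDiff_radialTest lam hχ hχU).continuous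
  have hΨ2 : MemLp (radialTest lam χ) 2 :=
    hΨc.memLp_of_hasCompactSupport (hasCompactSupport_radialTest hlam hχc hχU)
  have hint : Integrable fun z => angFourier G z * radialTest lam χ z :=
    (memLp_angFourier G).integrable_mul hΨ2
  rw [integral_eprod hint, ← integral_const_mul]
  refine integral_congr_ae ?_
  obtain ⟨e⟩ : Nonempty (Metric.sphere (0 : E (d + 1)) 1) :=
    (NormedSpace.sphere_nonempty.2 zero_le_one).to_subtype
  filter_upwards [(integrable_comp_toLp hint).prod_right_ae] with ξ hξ
  have h0 : ∀ η : ℝ, 0 < η → ∀ θ : Metric.sphere (0 : E (d + 1)) 1,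
      ‖η • (θ : E (d + 1))‖ = η := by
    intro η hη θ
    rw [norm_smul, norm_eq_of_mem_sphere, mul_one, Real.norm_of_nonneg hη.le]
  rw [integral_polar hξ]
  set S : ℂ := ((volume : Measure (E (d + 1))).toSphere.real univ : ℂ) with hS
  have h1 : ∀ η ∈ Ioi (0 : ℝ), η ^ d • ∫ θ : Metric.sphere (0 : E (d + 1)) 1,
      angFourier G (WithLp.toLp 2 (ξ, η • (θ : E (d + 1)))) *
        radialTest lam χ (WithLp.toLp 2 (ξ, η • (θ : E (d + 1))))
          ∂(volume : Measure (E (d + 1))).toSphere =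
      S * (η ^ d * tilde hg ξ η * radialTest lam χ (WithLp.toLp 2 (ξ, η • (e : E (d + 1))))) := by
    intro η hη
    have h2 : ∀ θ : Metric.sphere (0 : E (d + 1)) 1,
        radialTest lam χ (WithLp.toLp 2 (ξ, η • (θ : E (d + 1)))) =
          radialTest lam χ (WithLp.toLp 2 (ξ, η • (e : E (d + 1)))) :=
      fun θ => radialTest_radial χ ξ _ _ (by rw [h0 η hη, h0 η hη])
    simp only [h2, integral_mul_const]
    rw [sphere_integral_angFourier hg, Complex.real_smul]
    push_cast
    ring
  rw [setIntegral_congr_fun measurableSet_Ioi h1, integral_const_mul]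
  congr 1
  have h3 : ∫ η in Ioi (0 : ℝ), (η ^ d * tilde hg ξ η *
        radialTest lam χ (WithLp.toLp 2 (ξ, η • (e : E (d + 1)))) : ℂ) =
      ∫ η in Ioi √(tangentialSq lam ξ), (η ^ d * tilde hg ξ η *
        radialTest lam χ (WithLp.toLp 2 (ξ, η • (e : E (d + 1)))) : ℂ) := by
    -- the radii with `η² ≤ q(ξ)` do not contribute, since `χ(ξ, 0) = 0`
    refine setIntegral_eq_of_subset_of_forall_sdiff_eq_zero measurableSet_Ioi
      (Ioi_subset_Ioi (Real.sqrt_nonneg _)) fun η hη => ?_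
    have hη0 : 0 < η := hη.1
    have h4 : η ^ 2 - tangentialSq lam ξ ≤ 0 := by
      have := (Real.le_sqrt' hη0).1 (not_lt.1 hη.2)
      linarith
    have h5 : radialTest lam χ (WithLp.toLp 2 (ξ, η • (e : E (d + 1)))) = 0 := by
      change (χ (ξ, √(‖η • (e : E (d + 1))‖ ^ 2 - tangentialSq lam ξ) / lastAxis d lam) : ℂ) = 0
      rw [h0 η hη0, Real.sqrt_eq_zero_of_nonpos h4, zero_div,
        eq_zero_of_tsupport_subset hχU le_rfl, Complex.ofReal_zero]
    rw [h5, mul_zero]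
  rw [h3, ← integral_dilationNorm hlam]
  refine setIntegral_congr_fun measurableSet_Ioi fun κ hκ => ?_
  have h6 := radialTest_dilationNorm hlam χ ξ hκ
    (w := dilationNorm lam ξ κ • (e : E (d + 1))) (h0 _ (dilationNorm_pos hlam ξ hκ) e)
  simp only [h6]

open scoped ContDiff in
/-- On the side of `f`, evenness in `ξₙ` reduces the integral to the half space `ξₙ > 0`. -/
lemma integral_angFourier_mul_radialTest_adjoint {f : Lp ℂ 2 (volume : Measure (E (d + 1)))}
    (hf : ∀ᵐ x : E (d + 1), f (reflect x) = f x) (hlam : 1 < lam) (hχ : ContDiff ℝ ∞ χ)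
    (hχc : HasCompactSupport χ) (hχU : tsupport χ ⊆ {p | 0 < p.2}) :
    ∫ ξ, angFourier f ξ * radialTest lam χ ((ellipsoidMap d lam).adjoint ξ) =
      2 * ∫ p : E d × ℝ, angFourier f (join p) * χ p := by
  set X : E (d + 1) → ℂ := fun ξ => χ (WithLp.toLp 2 fun i : Fin d => ξ i.castSucc, ξ (Fin.last d))
    with hX
  have hXc : Continuous X := Complex.continuous_ofReal.comp (hχ.continuous.comp (by fun_prop))
  have hXj : ∀ p, X (join p) = χ p := by
    intro p
    simp only [hX, join_castSucc, join_last]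
  -- for each `ξ` one of the two summands vanishes, as `χ` lives on `κ > 0`
  have hsplit : ∀ ξ, radialTest lam χ ((ellipsoidMap d lam).adjoint ξ) = X ξ + X (reflect ξ) := by
    intro ξ
    rw [radialTest_adjoint hlam]
    simp only [hX, reflect_castSucc, reflect_last]
    rcases le_total 0 (ξ (Fin.last d)) with h | h
    · rw [abs_of_nonneg h, eq_zero_of_tsupport_subset hχU (p := (_, -ξ (Fin.last d))) (by simpa)]
      simp
    · rw [abs_of_nonpos h, eq_zero_of_tsupport_subset hχU (p := (_, ξ (Fin.last d))) (by simpa)]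
      simp
  have hXs : HasCompactSupport X := by
    have hjc : Continuous (join : E d × ℝ → E (d + 1)) := by
      unfold join
      refine (PiLp.continuous_toLp 2 _).comp (continuous_pi fun i => ?_)
      induction i using Fin.lastCases with
      | last => simpa using continuous_snd
      | cast i => simp only [Fin.snoc_castSucc]; fun_prop
    refine HasCompactSupport.intro (hχc.isCompact.image hjc) fun ξ hξ => ?_
    have hjξ : join (WithLp.toLp 2 fun i : Fin d => ξ i.castSucc, ξ (Fin.last d)) = ξ := by
      ext i
      induction i using Fin.lastCases <;> simp
    simp only [hX]
    rw [image_eq_zero_of_notMem_tsupport (f := χ), Complex.ofReal_zero]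
    intro hmem
    exact hξ ⟨_, hmem, hjξ⟩
  have hX2 : MemLp X 2 := hXc.memLp_of_hasCompactSupport hXs
  have hX2' : MemLp (fun ξ => X (reflect ξ)) 2 :=
    hX2.comp_measurePreserving (measurePreserving_reflect d)
  have hi1 : Integrable fun ξ => angFourier f ξ * X ξ := (memLp_angFourier f).integrable_mul hX2
  have hi2 : Integrable fun ξ => angFourier f ξ * X (reflect ξ) :=
    (memLp_angFourier f).integrable_mul hX2'
  have hrefl : ∫ ξ, angFourier f ξ * X (reflect ξ) = ∫ ξ, angFourier f ξ * X ξ := by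
    rw [← (measurePreserving_reflect d).integral_comp (measurableEmbedding_reflect d)
      fun ξ => angFourier f ξ * X ξ]
    refine integral_congr_ae ?_
    filter_upwards [angFourier_reflect_ae hf] with ξ hξ
    rw [hξ]
  simp only [hsplit, mul_add]
  rw [integral_add hi1 hi2, hrefl, ← two_mul, ← integral_join hi1.1]
  simp only [hXj]

end

/-! ### The pointwise identity of Fourier transforms -/

section

open scoped SchwartzMap

lemma volume_restrict_upperHalf (d : ℕ) :
    (volume : Measure (E d × ℝ)).restrict {p | 0 < p.2} =
      (volume : Measure (E d)).prod ((volume : Measure ℝ).restrict (Ioi 0)) := by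
  have : {p : E d × ℝ | 0 < p.2} = univ ×ˢ Ioi (0 : ℝ) := by ext p; simp
  rw [this, Measure.volume_eq_prod, ← Measure.prod_restrict, Measure.restrict_univ]

/-- The square of the data norm of order `s`. -/
def dataEnergy {d : ℕ} (s : ℝ) {g : E d → ℝ → ℂ} (hg : MemL2Radial g) : ℝ≥0∞ :=
  ∫⁻ ξ : E d, ∫⁻ η in Ioi (0 : ℝ), ‖tilde hg ξ η‖ₑ ^ 2 *
    ENNReal.ofReal ((1 + ‖ξ‖ ^ 2 + η ^ 2) ^ s * η ^ d)

variable {d : ℕ} {lam : ℝ}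

/-- `g̃(ξ', |D ξ|)`, times the density of `|D ξ|ⁿ⁻¹ d|D ξ|` with respect to `dξₙ`. -/
def pullTilde (lam : ℝ) {g : E d → ℝ → ℂ} (hg : MemL2Radial g) (p : E d × ℝ) : ℂ :=
  dilationNormDeriv lam p.1 p.2 *
    (dilationNorm lam p.1 p.2 ^ d * tilde hg p.1 (dilationNorm lam p.1 p.2))

lemma measurable_dilationNormDeriv (lam : ℝ) :
    Measurable fun p : E d × ℝ => dilationNormDeriv lam p.1 p.2 :=
  (measurable_snd.const_mul _).div (continuous_dilationNorm lam).measurable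

lemma measurable_tilde_dilationNorm (lam : ℝ) {g : E d → ℝ → ℂ} (hg : MemL2Radial g) :
    Measurable fun p : E d × ℝ => tilde hg p.1 (dilationNorm lam p.1 p.2) :=
  (stronglyMeasurable_tilde hg).measurable.comp
    (measurable_fst.prodMk (continuous_dilationNorm lam).measurable)

lemma measurable_pullTilde (lam : ℝ) {g : E d → ℝ → ℂ} (hg : MemL2Radial g) :
    Measurable (pullTilde lam hg) :=
  (Complex.measurable_ofReal.comp (measurable_dilationNormDeriv lam)).mul
    (((Complex.measurable_ofReal.comp (continuous_dilationNorm lam).measurable).pow_const d).mul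
      (measurable_tilde_dilationNorm lam hg))

/-- The change of variables `η = |D (ξ', κ)|` in the energy of the data. -/
lemma lintegral_dilationNorm_le_dataEnergy (hlam : 1 < lam) (s : ℝ) {g : E d → ℝ → ℂ}
    (hg : MemL2Radial g) :
    ∫⁻ ξ : E d, ∫⁻ κ in Ioi (0 : ℝ), ENNReal.ofReal (dilationNormDeriv lam ξ κ) *
      (‖tilde hg ξ (dilationNorm lam ξ κ)‖ₑ ^ 2 *
        ENNReal.ofReal ((1 + ‖ξ‖ ^ 2 + dilationNorm lam ξ κ ^ 2) ^ s * dilationNorm lam ξ κ ^ d)) ≤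
      dataEnergy s hg := by
  refine lintegral_mono fun ξ => ?_
  rw [lintegral_dilationNorm hlam ξ fun η => ‖tilde hg ξ η‖ₑ ^ 2 *
    ENNReal.ofReal ((1 + ‖ξ‖ ^ 2 + η ^ 2) ^ s * η ^ d)]
  exact lintegral_mono_set (Ioi_subset_Ioi (Real.sqrt_nonneg _))

/-- Finite energy makes the pulled back transform locally integrable, as the uniqueness argument for
test functions requires. -/
lemma locallyIntegrableOn_pullTilde (hlam : 1 < lam) {s : ℝ} (hs : 0 ≤ s) {g : E d → ℝ → ℂ}
    (hg : MemL2Radial g) (hfin : dataEnergy s hg ≠ ∞) :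
    LocallyIntegrableOn (pullTilde lam hg) {p | 0 < p.2} := by
  have hU : IsOpen {p : E d × ℝ | 0 < p.2} := isOpen_lt continuous_const continuous_snd
  rw [locallyIntegrableOn_iff hU.isLocallyClosed]
  intro K hKU hK
  set w : E d × ℝ → ℝ := fun p => dilationNormDeriv lam p.1 p.2 * dilationNorm lam p.1 p.2 ^ d
    with hw
  have hwK : IntegrableOn w K := by
    refine ContinuousOn.integrableOn_compact hK ?_
    have hc := (continuous_dilationNorm (d := d) lam).continuousOn (s := K)
    refine ContinuousOn.mul (ContinuousOn.div (by fun_prop) hc fun p hp => ?_) (hc.pow d)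
    exact (dilationNorm_pos hlam _ (hKU hp)).ne'
  set T : E d × ℝ → ℝ≥0∞ := fun p => ENNReal.ofReal (dilationNormDeriv lam p.1 p.2) *
      (‖tilde hg p.1 (dilationNorm lam p.1 p.2)‖ₑ ^ 2 *
        ENNReal.ofReal ((1 + ‖p.1‖ ^ 2 + dilationNorm lam p.1 p.2 ^ 2) ^ s *
          dilationNorm lam p.1 p.2 ^ d)) with hT
  have hTm : Measurable T := by
    have h1 := (measurable_dilationNormDeriv (d := d) lam)
    have h2 := measurable_tilde_dilationNorm lam hg
    have h3 := (continuous_dilationNorm (d := d) lam).measurable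
    exact h1.ennreal_ofReal.mul ((h2.enorm.pow_const 2).mul
      ((((by fun_prop : Measurable fun p : E d × ℝ => 1 + ‖p.1‖ ^ 2).add
        (h3.pow_const 2)).pow_const s).mul (h3.pow_const d)).ennreal_ofReal)
  have hTfin : ∫⁻ p in K, T p < ∞ := by
    refine (lintegral_mono_set hKU).trans_lt ?_
    rw [volume_restrict_upperHalf, lintegral_prod _ hTm.aemeasurable]
    exact (lintegral_dilationNorm_le_dataEnergy hlam s hg).trans_lt hfin.lt_top
  refine ⟨(measurable_pullTilde lam hg).aestronglyMeasurable, ?_⟩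
  rw [hasFiniteIntegral_iff_enorm]
  calc ∫⁻ p in K, ‖pullTilde lam hg p‖ₑ ≤ ∫⁻ p in K, (‖w p‖ₑ + T p) := by
        refine setLIntegral_mono' hK.measurableSet fun p hp => ?_
        have hp0 : 0 < p.2 := hKU hp
        have hh := dilationNorm_pos hlam p.1 hp0
        have hJ := dilationNormDeriv_nonneg lam p.1 hp0
        set b := tilde hg p.1 (dilationNorm lam p.1 p.2) with hb
        -- `|b| ≤ 1 + |b|²`, and the weight `(1 + |ξ|² + η²) ^ s` is at least `1`
        have h1 : T p = ENNReal.ofReal (dilationNormDeriv lam p.1 p.2 * (‖b‖ ^ 2 *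
            ((1 + ‖p.1‖ ^ 2 + dilationNorm lam p.1 p.2 ^ 2) ^ s *
              dilationNorm lam p.1 p.2 ^ d))) := by
          rw [ENNReal.ofReal_mul hJ, ENNReal.ofReal_mul (sq_nonneg _),
            ENNReal.ofReal_pow (norm_nonneg _), ofReal_norm]
        rw [h1, Real.enorm_of_nonneg (mul_nonneg hJ (pow_nonneg hh.le _)),
          ← ENNReal.ofReal_add (by positivity) (by positivity), ← ofReal_norm]
        refine ENNReal.ofReal_le_ofReal ?_
        have h2 : ‖pullTilde lam hg p‖ = dilationNormDeriv lam p.1 p.2 *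
            (dilationNorm lam p.1 p.2 ^ d * ‖b‖) := by
          rw [pullTilde, norm_mul, norm_mul, norm_pow, Complex.norm_of_nonneg hJ,
            Complex.norm_of_nonneg hh.le]
        have h3 : 1 ≤ (1 + ‖p.1‖ ^ 2 + dilationNorm lam p.1 p.2 ^ 2) ^ s := by
          refine Real.one_le_rpow ?_ hs
          linarith [sq_nonneg ‖p.1‖, sq_nonneg (dilationNorm lam p.1 p.2)]
        have h4 : ‖b‖ ≤ 1 + ‖b‖ ^ 2 * (1 + ‖p.1‖ ^ 2 + dilationNorm lam p.1 p.2 ^ 2) ^ s := by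
          nlinarith [sq_nonneg (‖b‖ - 1), sq_nonneg ‖b‖]
        rw [h2]
        calc dilationNormDeriv lam p.1 p.2 * (dilationNorm lam p.1 p.2 ^ d * ‖b‖) ≤
            dilationNormDeriv lam p.1 p.2 * (dilationNorm lam p.1 p.2 ^ d *
              (1 + ‖b‖ ^ 2 * (1 + ‖p.1‖ ^ 2 + dilationNorm lam p.1 p.2 ^ 2) ^ s)) := by gcongr
          _ = _ := by ring
    _ = (∫⁻ p in K, ‖w p‖ₑ) + ∫⁻ p in K, T p := lintegral_add_right _ hTm
    _ < ∞ := ENNReal.add_lt_top.2 ⟨hwK.2, hTfin⟩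

/-- The pointwise relation between the Fourier transforms of the data and of `f`: both sides have
the same integrals against all test functions supported in `κ > 0`. -/
lemma pullTilde_dataRE_ae (hd : 1 ≤ d) (hlam : 1 < lam) {s : ℝ} (hs : 0 ≤ s)
    (f : Lp ℂ 2 (volume : Measure (E (d + 1))))
    (hf : ∀ᵐ x : E (d + 1), f (reflect x) = f x) (hg : MemL2Radial (dataRE lam f))
    (hfin : dataEnergy s hg ≠ ∞) :
    ∀ᵐ p : E d × ℝ, 0 < p.2 →
      angFourier f (join p) = ((volume : Measure (E (d + 1))).toSphere.real univ /
        (2 * fourierConst d lam) : ℝ) * pullTilde lam hg p := by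
  have hU : IsOpen {p : E d × ℝ | 0 < p.2} := isOpen_lt continuous_const continuous_snd
  set S := (volume : Measure (E (d + 1))).toSphere.real univ with hS
  have hS0 : 0 < S := toSphere_real_pos d
  have hK0 := fourierConst_pos (d := d) hlam
  have hB := locallyIntegrableOn_pullTilde hlam hs hg hfin
  have ha2 : MemLp (fun p : E d × ℝ => angFourier f (join p)) 2 :=
    (memLp_angFourier f).comp_measurePreserving (measurePreserving_join d)
  have ha : LocallyIntegrable (fun p : E d × ℝ => angFourier f (join p)) volume :=
    ha2.locallyIntegrable (by norm_num)
  have hdiff : LocallyIntegrableOn (fun p : E d × ℝ => (S : ℂ) • pullTilde lam hg p -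
      ((2 * fourierConst d lam : ℝ) : ℂ) • angFourier f (join p)) {p | 0 < p.2} :=
    (hB.smul (S : ℂ)).sub ((ha.locallyIntegrableOn _).smul ((2 * fourierConst d lam : ℝ) : ℂ))
  have h := hU.ae_eq_zero_of_integral_contDiff_smul_eq_zero hdiff fun χ hχ hχc hχU => ?_
  · filter_upwards [h] with p hp hp0
    have h1 := sub_eq_zero.1 (hp hp0)
    simp only [smul_eq_mul] at h1
    have h2 : ((2 * fourierConst d lam : ℝ) : ℂ) ≠ 0 := by
      exact_mod_cast (mul_pos two_pos hK0).ne'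
    rw [Complex.ofReal_div, div_mul_eq_mul_div, eq_div_iff h2, h1]
    ring
  · let Ψ : 𝓢(EProd d, ℂ) := (hasCompactSupport_radialTest hlam hχc hχU).toSchwartzMap
      (contDiff_radialTest lam hχ hχU)
    have hΨ : ∀ z, Ψ z = radialTest lam χ z := fun z => rfl
    have hmain := integral_angFourier_radialLift hd hlam f hg (Ψ := Ψ) (radialTest_radial χ)
    simp only [hΨ] at hmain
    rw [integral_angFourier_mul_radialTest hg hlam hχ hχc hχU,
      integral_angFourier_mul_radialTest_adjoint hf hlam hχ hχc hχU] at hmain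
    have hiB : Integrable fun p => χ p • pullTilde lam hg p := by
      have h1 : IntegrableOn (pullTilde lam hg) (tsupport χ) :=
        hB.integrableOn_compact_subset hχU hχc.isCompact
      have h2 := h1.continuousOn_smul hχ.continuous.continuousOn hχc.isCompact
      rw [← integrableOn_iff_integrable_of_support_subset (s := tsupport χ)]
      · exact h2
      · exact fun p hp => subset_tsupport χ (left_ne_zero_of_smul hp)
    have hia : Integrable fun p => χ p • angFourier f (join p) := by
      have h1 : IntegrableOn (fun p => angFourier f (join p)) (tsupport χ) :=
        ha.integrableOn_isCompact hχc.isCompact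
      have h2 := h1.continuousOn_smul hχ.continuous.continuousOn hχc.isCompact
      rw [← integrableOn_iff_integrable_of_support_subset (s := tsupport χ)]
      · exact h2
      · exact fun p hp => subset_tsupport χ (left_ne_zero_of_smul hp)
    have hIB : ∫ p, χ p • pullTilde lam hg p = ∫ ξ : E d, ∫ κ in Ioi (0 : ℝ),
        dilationNormDeriv lam ξ κ * (dilationNorm lam ξ κ ^ d *
          tilde hg ξ (dilationNorm lam ξ κ) * χ (ξ, κ)) := by
      rw [Measure.volume_eq_prod] at hiB ⊢
      rw [integral_prod _ hiB]
      congr 1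
      ext ξ
      rw [← setIntegral_eq_integral_of_forall_compl_eq_zero (s := Ioi (0 : ℝ))]
      · refine setIntegral_congr_fun measurableSet_Ioi fun κ _ => ?_
        simp only [pullTilde, Complex.real_smul]
        ring
      · intro κ hκ
        rw [eq_zero_of_tsupport_subset hχU (p := (ξ, κ)) (not_lt.1 hκ), zero_smul]
    have hIa : ∫ p, χ p • angFourier f (join p) = ∫ p, angFourier f (join p) * χ p := by
      simp only [Complex.real_smul, mul_comm]
    calc ∫ p, χ p • ((S : ℂ) • pullTilde lam hg p -
          ((2 * fourierConst d lam : ℝ) : ℂ) • angFourier f (join p))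
        = ∫ p, ((S : ℂ) * (χ p • pullTilde lam hg p) -
          ((2 * fourierConst d lam : ℝ) : ℂ) * (χ p • angFourier f (join p))) := by
          congr 1
          ext p
          simp only [Complex.real_smul, smul_eq_mul]
          ring
      _ = 0 := by
          rw [integral_sub (hiB.const_mul _) (hia.const_mul _), integral_const_mul,
            integral_const_mul, hIB, hIa, hmain]
          push_cast
          ring

end

/-! ### The stability estimate -/

section

variable {d : ℕ} {lam : ℝ}

/-- The integral of a nonnegative function on `ℝᵈ⁺¹` that is even in `ξₙ` is at most twice its
integral over the half space `ξₙ > 0`. -/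
lemma lintegral_le_two_mul_upperHalf {F : E (d + 1) → ℝ≥0∞} (hF : Measurable F)
    (heven : ∀ᵐ ξ, F (reflect ξ) = F ξ) :
    ∫⁻ ξ, F ξ ≤ 2 * ∫⁻ ξ : E d, ∫⁻ κ in Ioi (0 : ℝ), F (join (ξ, κ)) := by
  set P : Set (E (d + 1)) := {ξ | 0 < ξ (Fin.last d)} with hP
  have hPm : MeasurableSet P := measurableSet_lt measurable_const (by fun_prop)
  have hnull : ∀ᵐ ξ : E (d + 1), ξ (Fin.last d) ≠ 0 := by
    rw [← (measurePreserving_join d).map_eq,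
      ae_map_iff (measurePreserving_join d).measurable.aemeasurable
        (show MeasurableSet {ξ : E (d + 1) | ξ (Fin.last d) ≠ 0} from
          (measurableSet_eq_fun (f := fun ξ : E (d + 1) => ξ (Fin.last d)) (g := fun _ => (0 : ℝ))
            (by fun_prop) measurable_const).compl)]
    simp only [join_last]
    have h1 : ∀ᵐ κ : ℝ, κ ≠ 0 := by simp [ae_iff]
    exact (Measure.quasiMeasurePreserving_snd (μ := (volume : Measure (E d)))
      (ν := (volume : Measure ℝ))).ae h1
  have hrefl : ∫⁻ ξ, P.indicator F (reflect ξ) = ∫⁻ ξ, P.indicator F ξ :=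
    (measurePreserving_reflect d).lintegral_comp (hF.indicator hPm)
  calc ∫⁻ ξ, F ξ ≤ ∫⁻ ξ, (P.indicator F ξ + P.indicator F (reflect ξ)) := by
        refine lintegral_mono_ae ?_
        filter_upwards [hnull, heven] with ξ h1 h2
        rcases lt_or_gt_of_ne h1 with h | h
        · have : reflect ξ ∈ P := by
            rw [hP, mem_ofPred_eq, reflect_last]
            linarith
          rw [indicator_of_mem this, h2]
          exact le_add_self
        · have : ξ ∈ P := h
          rw [indicator_of_mem this]
          exact le_self_add
    _ = 2 * ∫⁻ ξ in P, F ξ := by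
        rw [lintegral_add_left (hF.indicator hPm), hrefl, ← two_mul, lintegral_indicator hPm]
    _ = 2 * ∫⁻ ξ : E d, ∫⁻ κ in Ioi (0 : ℝ), F (join (ξ, κ)) := by
        have h1 := (measurePreserving_join d).setLIntegral_comp_preimage hPm hF
        have h2 : join ⁻¹' P = {p : E d × ℝ | 0 < p.2} := by
          ext p
          simp [hP]
        rw [← h1, h2, volume_restrict_upperHalf, lintegral_prod (fun p => F (join p))
          (hF.comp (measurePreserving_join d).measurable).aemeasurable]

/-- The pointwise comparison of the weights of the two Sobolev norms: with `η = |D (ξ', κ)| ≥ ν κ`,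
the factor `ηᵈ` that the data gain is absorbed by `(1 + |ξ'|² + η²) ^ (d / 2)`. -/
lemma weight_le (hlam : 1 < lam) {γ : ℝ} (hγ : 0 ≤ γ) (ξ : E d) {κ : ℝ} (hκ : 0 < κ) :
    dilationNormDeriv lam ξ κ * dilationNorm lam ξ κ ^ d * (1 + (‖ξ‖ ^ 2 + κ ^ 2)) ^ γ ≤
      lastAxis d lam * (1 + (lastAxis d lam ^ 2)⁻¹) ^ γ *
        (1 + ‖ξ‖ ^ 2 + dilationNorm lam ξ κ ^ 2) ^ (γ + (d : ℝ) / 2) := by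
  have hν := lastAxis_pos (d := d) hlam
  have hη := dilationNorm_pos hlam ξ hκ
  have hsq := sq_dilationNorm lam ξ κ
  have hq := tangentialSq_nonneg lam ξ
  set ν := lastAxis d lam
  set η := dilationNorm lam ξ κ with hηdef
  have hνκ : ν * κ ≤ η := by
    refine (sq_le_sq₀ (by positivity) hη.le).1 ?_
    linarith
  have hJ : dilationNormDeriv lam ξ κ ≤ ν := by
    rw [dilationNormDeriv, div_le_iff₀ hη]
    change ν ^ 2 * κ ≤ ν * η
    nlinarith
  have hJ0 := dilationNormDeriv_nonneg lam ξ hκ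
  set A : ℝ := 1 + ‖ξ‖ ^ 2 + η ^ 2 with hA
  have hA0 : 0 < A := by positivity
  have h1 : η ^ d ≤ A ^ ((d : ℝ) / 2) := by
    have h2 : η ^ d = (η ^ 2) ^ ((d : ℝ) / 2) := by
      rw [← Real.rpow_natCast η 2, ← Real.rpow_mul hη.le, ← Real.rpow_natCast η d]
      congr 1
      push_cast
      ring
    rw [h2]
    refine Real.rpow_le_rpow (by positivity) ?_ (by positivity)
    rw [hA]
    linarith [sq_nonneg ‖ξ‖]
  have h3 : (1 + (‖ξ‖ ^ 2 + κ ^ 2)) ^ γ ≤ (1 + (ν ^ 2)⁻¹) ^ γ * A ^ γ := by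
    rw [← Real.mul_rpow (by positivity) hA0.le]
    refine Real.rpow_le_rpow (by positivity) ?_ hγ
    have h4 : κ ^ 2 ≤ (ν ^ 2)⁻¹ * η ^ 2 := by
      rw [inv_mul_eq_div, le_div_iff₀ (by positivity), hsq]
      nlinarith
    have h5 : 0 ≤ (ν ^ 2)⁻¹ * (1 + ‖ξ‖ ^ 2) := by positivity
    rw [hA]
    nlinarith [sq_nonneg η]
  calc dilationNormDeriv lam ξ κ * η ^ d * (1 + (‖ξ‖ ^ 2 + κ ^ 2)) ^ γ
      ≤ ν * A ^ ((d : ℝ) / 2) * ((1 + (ν ^ 2)⁻¹) ^ γ * A ^ γ) := by gcongr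
    _ = _ := by
      rw [Real.rpow_add hA0]
      ring

/-- The constant in the squared stability estimate. -/
def stabilityConst (d : ℕ) (lam γ : ℝ) : ℝ :=
  2 * (((volume : Measure (E (d + 1))).toSphere.real univ / (2 * fourierConst d lam)) ^ 2 *
    (lastAxis d lam * (1 + (lastAxis d lam ^ 2)⁻¹) ^ γ))

lemma stabilityConst_pos (hlam : 1 < lam) (γ : ℝ) : 0 < stabilityConst d lam γ := by
  have h1 := toSphere_real_pos d
  have h2 := fourierConst_pos (d := d) hlam
  have h3 := lastAxis_pos (d := d) hlam
  unfold stabilityConst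
  positivity

/-- The squared stability estimate, for data in `L²`. -/
lemma lintegral_angFourier_le_dataEnergy (hd : 1 ≤ d) (hlam : 1 < lam) {γ : ℝ} (hγ : 0 ≤ γ)
    (f : Lp ℂ 2 (volume : Measure (E (d + 1))))
    (hf : ∀ᵐ x : E (d + 1), f (reflect x) = f x) (hg : MemL2Radial (dataRE lam f)) :
    ∫⁻ ξ : E (d + 1), ‖angFourier f ξ‖ₑ ^ 2 * ENNReal.ofReal ((1 + ‖ξ‖ ^ 2) ^ γ) ≤
      ENNReal.ofReal (stabilityConst d lam γ) * dataEnergy (γ + (d : ℝ) / 2) hg := by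
  have hC := stabilityConst_pos (d := d) hlam γ
  -- the relation between `f̂` and `g̃` is available only for data of finite energy
  by_cases hfin : dataEnergy (γ + (d : ℝ) / 2) hg = ∞
  · rw [hfin, ENNReal.mul_top (ENNReal.ofReal_pos.2 hC).ne']
    exact le_top
  set c : ℝ := (volume : Measure (E (d + 1))).toSphere.real univ / (2 * fourierConst d lam) with hc
  set C₁ : ℝ := lastAxis d lam * (1 + (lastAxis d lam ^ 2)⁻¹) ^ γ with hC₁
  have hc0 : 0 ≤ c := (div_pos (toSphere_real_pos d) (mul_pos two_pos (fourierConst_pos hlam))).le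
  have hν := lastAxis_pos (d := d) hlam
  have hC₁0 : 0 ≤ C₁ := by positivity
  have hFm : Measurable fun ξ : E (d + 1) =>
      ‖angFourier f ξ‖ₑ ^ 2 * ENNReal.ofReal ((1 + ‖ξ‖ ^ 2) ^ γ) :=
    ((stronglyMeasurable_angFourier f).measurable.enorm.pow_const 2).mul (by fun_prop)
  have hnorm : ∀ ξ : E (d + 1), ‖reflect ξ‖ = ‖ξ‖ := fun ξ => by
    rw [← reflectEquiv_apply, LinearIsometryEquiv.norm_map]
  have hae := pullTilde_dataRE_ae hd hlam (s := γ + (d : ℝ) / 2) (by positivity) f hf hg hfin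
  rw [Measure.volume_eq_prod] at hae
  refine (lintegral_le_two_mul_upperHalf hFm ?_).trans ?_
  · filter_upwards [angFourier_reflect_ae hf] with ξ hξ
    rw [hξ, hnorm]
  have hstab : ENNReal.ofReal (stabilityConst d lam γ) =
      2 * ENNReal.ofReal (c ^ 2 * C₁) := by
    rw [stabilityConst, ENNReal.ofReal_mul two_pos.le, ENNReal.ofReal_ofNat]
  rw [hstab, mul_assoc]
  gcongr
  refine le_trans ?_ (mul_le_mul_right (lintegral_dilationNorm_le_dataEnergy hlam
    (γ + (d : ℝ) / 2) hg) _)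
  rw [← lintegral_const_mul' _ _ ENNReal.ofReal_ne_top]
  refine lintegral_mono_ae ?_
  filter_upwards [Measure.ae_ae_of_ae_prod hae] with ξ hξ
  rw [← lintegral_const_mul' _ _ ENNReal.ofReal_ne_top]
  refine setLIntegral_mono_ae' measurableSet_Ioi ?_
  filter_upwards [hξ] with κ hκ hκ0
  have hη := dilationNorm_pos hlam ξ hκ0
  have hJ := dilationNormDeriv_nonneg lam ξ hκ0
  have hw := weight_le hlam hγ ξ hκ0
  rw [hκ hκ0, norm_join_sq, ← ofReal_norm, ← ofReal_norm, norm_mul, pullTilde, norm_mul, norm_mul,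
    norm_pow, Complex.norm_of_nonneg hc0, Complex.norm_of_nonneg hJ, Complex.norm_of_nonneg hη.le]
  set b := ‖tilde hg ξ (dilationNorm lam ξ κ)‖ with hb
  set J := dilationNormDeriv lam ξ κ
  set η := dilationNorm lam ξ κ
  have hb0 : 0 ≤ b := norm_nonneg _
  rw [← ENNReal.ofReal_pow (by positivity), ← ENNReal.ofReal_pow (by positivity),
    ← ENNReal.ofReal_mul (by positivity), ← ENNReal.ofReal_mul (by positivity),
    ← ENNReal.ofReal_mul (by positivity), ← ENNReal.ofReal_mul (by positivity)]
  refine ENNReal.ofReal_le_ofReal ?_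
  calc (c * (J * (η ^ d * b))) ^ 2 * (1 + (‖ξ‖ ^ 2 + κ ^ 2)) ^ γ
      = c ^ 2 * J * b ^ 2 * η ^ d * (J * η ^ d * (1 + (‖ξ‖ ^ 2 + κ ^ 2)) ^ γ) := by ring
    _ ≤ c ^ 2 * J * b ^ 2 * η ^ d *
        (C₁ * (1 + ‖ξ‖ ^ 2 + η ^ 2) ^ (γ + (d : ℝ) / 2)) := by gcongr
    _ = _ := by ring

end

end EllipticalRadon

end

theorem mainTheorem4 (d : ℕ) (hd : 1 ≤ d) (lam : ℝ) (hlam : 1 < lam) (γ : ℝ) (hγ : 0 ≤ γ) :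
    ∃ C : ℝ, 0 < C ∧ ∀ f ∈ EllipticalRadon.sobolevEven d γ,
      EllipticalRadon.sobolevNorm γ f ≤
        ENNReal.ofReal C *
          EllipticalRadon.dataNorm (γ + (d : ℝ) / 2)
            (EllipticalRadon.dataRE lam (f : EllipticalRadon.E (d + 1) → ℂ)) := by
  have hC := EllipticalRadon.stabilityConst_pos (d := d) hlam γ
  refine ⟨EllipticalRadon.stabilityConst d lam γ ^ (1 / 2 : ℝ), by positivity, fun f hf => ?_⟩
  by_cases hg : EllipticalRadon.MemL2Radial (EllipticalRadon.dataRE lam f)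
  · rw [EllipticalRadon.dataNorm, dif_pos hg, EllipticalRadon.sobolevNorm,
      ← ENNReal.ofReal_rpow_of_pos hC, ← ENNReal.mul_rpow_of_nonneg _ _ (by norm_num)]
    exact ENNReal.rpow_le_rpow
      (EllipticalRadon.lintegral_angFourier_le_dataEnergy hd hlam hγ f hf.2 hg) (by norm_num)
  · rw [EllipticalRadon.dataNorm, dif_neg hg, ENNReal.mul_top]
    · exact le_top
    · exact (ENNReal.ofReal_pos.2 (by positivity)).ne'
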